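/- Let $X\subset\mathbb R^n$ be a finite set of points with weights $w\colon X\to\mathbb R$. A sphere $S$ with center $z\in\mathbb R^n$ and squared radius $s\in\mathbb R$ (possibly negative) \emph{includes} $x\in X$ if $\|z-x\|^2\le s+w_x$, \emph{excludes} $x$ if $\|z-x\|^2\ge s+w_x$, and $x$ \emph{lies on} $S$ if both hold. Assume that $X$ is in \emph{general position}: every $Q\subseteq X$ of at most $n+1$ points is affinely independent, and no point of $X\setminus Q$ lies on the smallest circumsphere of $Q$ (the sphere of least squared radius on which all points of $Q$ lie, if there is one). For $s\in\mathbb R$ and $x\in X$ let $B_s(x)=\{y:\|y-x\|^2\le s+w_x\}$ and $\mathrm{Vor}(x)=\{y:\|y-x\|^2-w_x\le\|y-p\|^2-w_p\ \forall p\in X\}$, and define simplicial complexes of nonempty subsets $Q\subseteq X$ by $$\check{\mathrm C}_s=\Big\{Q:\bigcap_{x\in Q}B_s(x)\ne\emptyset\Big\},\qquad \mathrm{Del}=\Big\{Q:\bigcap_{x\in Q}\mathrm{Vor}(x)\neq\emptyset\Big\},$$ $$\mathrm{Del}\check{\mathrm C}_s=\mathrm{Del}\cap\check{\mathrm C}_s,\qquad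 \mathrm{Del}_s=\Big\{Q:\bigcap_{x\in Q}\big(B_s(x)\cap\mathrm{Vor}(x)\big)\neq\emptyset\Big\}.$$ For $Q\in\mathrm{Del}$ let $S(Q)$ be its Delaunay sphere, i.e. the sphere of least squared radius that includes every point of $Q$ and excludes every point of $X$. Let $\mathrm{On}\,S$ be the set of points of $X$ on $S$, write the center of $S=S(Q)$ as the affine combination $\sum_{x\in\mathrm{On}\,S}\rho_x x$, and let $\mathrm{Front}\,S=\{x\in\mathrm{On}\,S:\rho_x>0\}$. Let $V$ be the set of intervals $[\mathrm{Front}\,S,\mathrm{On}\,S]=\{P:\mathrm{Front}\,S\subseteq P\subseteq\mathrm{On}\,S\}$ over all $S=S(Q)$, $Q\in\mathrm{Del}$, made into a directed graph with an arc from $\mu$ to $\nu$ whenever $P\subseteq Q$ for some $P\in\mu$, $Q\in\nu$. The Wrap complex $\mathrm{Wrap}_s$ is the union of all intervals in $V$ from which a singular interval $[Q,Q]\in V$ whose sphere $S(Q)$ has squared radius at most $s$ can be reached along a directed path (possibly of length zero). Then $\mathrm{Wrap}_s$ is a simplicial complex for every $s\in\mathbb R$, and $$\check{\mathrm C}_s\searrow\mathrm{Del}\check{\mathrm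 C}_s\searrow\mathrm{Del}_s\searrow\mathrm{Wrap}_s\qquad\text{for every } s\in\mathbb R,$$ where $K\searrow L$ means that $L$ is obtained from $K$ by a finite sequence of elementary collapses. The inclusions $\mathrm{Wrap}_s\subseteq\mathrm{Del}_s\subseteq\mathrm{Del}\check{\mathrm C}_s\subseteq\check{\mathrm C}_s$, which commute with the inclusions $K_s\subseteq K_t$ ($s\le t$) of each filtration, induce isomorphisms of persistent homology: for every ring $R$, every $R$-module $M$ and every $p\ge0$, the induced natural transformations between the diagrams $s\mapsto H_p(K_s;M)$, $s\in\mathbb R$, of singular homology groups of the geometric realizations are isomorphisms. In particular, the Čech, Delaunay–Čech, Delaunay and Wrap filtrations have isomorphic persistent homology. -/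

import Mathlib

open CategoryTheory

universe u

noncomputable section

namespace WeightedDelaunay

/-! ### Simplicial complexes: geometric realization, collapses, persistent homology -/

section Complexes

/-- The geometric realization of an abstract simplicial complex on a finite vertex set `V`:
the union, over the faces `σ`, of the closed simplices spanned by the basis vectors
of `ℝ^V` indexed by `σ`. -/
def realization {V : Type} [Fintype V] (K : PreAbstractSimplicialComplex V) : Set (V → ℝ) :=
  {f | f ∈ stdSimplex ℝ V ∧ ∃ σ ∈ K.faces, ∀ v, v ∉ σ → f v = 0}

theorem realization_mono {V : Type} [Fintype V] {K L : PreAbstractSimplicialComplex V}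
    (h : K ≤ L) : realization K ⊆ realization L := by
  rintro f ⟨hf, σ, hσ, hv⟩
  exact ⟨hf, σ, h hσ, hv⟩

/-- Geometric realization as a functor from the poset of complexes on `V` (ordered by inclusion)
to topological spaces: an inclusion `K ≤ L` is sent to the inclusion of realizations. -/
def realizationFunctor (V : Type) [Fintype V] : PreAbstractSimplicialComplex V ⥤ TopCat.{0} where
  obj K := TopCat.of (realization K)
  map f := TopCat.ofHom
    ⟨Set.inclusion (realization_mono (leOfHom f)), continuous_inclusion _⟩

/-- `L` is obtained from `K` by an elementary collapse: `σ` is a face of `K` that is a facet of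
`τ` and has no proper coface in `K` other than `τ`, and `L` arises from `K` by removing both. -/
def ElementaryCollapse {V : Type} (K L : PreAbstractSimplicialComplex V) : Prop :=
  ∃ σ ∈ K.faces, ∃ τ ∈ K.faces, σ ⊂ τ ∧ τ.card = σ.card + 1 ∧
    (∀ ρ ∈ K.faces, σ ⊂ ρ → ρ = τ) ∧ L.faces = K.faces \ {σ, τ}

/-- `K ↘ L`: there is a finite sequence of elementary collapses from `K` to `L`. -/
def Collapses {V : Type} (K L : PreAbstractSimplicialComplex V) : Prop :=
  Relation.ReflTransGen ElementaryCollapse K L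

/-- The diagram of topological spaces of a filtration indexed by `ℝ`. -/
def filtrationFunctor {V : Type} [Fintype V] (K : ℝ →o PreAbstractSimplicialComplex V) :
    ℝ ⥤ TopCat.{0} :=
  K.monotone.functor ⋙ realizationFunctor V

/-- The natural transformation of filtrations formed by the inclusions `K s ⊆ L s`. -/
def filtrationInclusion {V : Type} [Fintype V] {K L : ℝ →o PreAbstractSimplicialComplex V}
    (h : K ≤ L) : filtrationFunctor K ⟶ filtrationFunctor L where
  app s := (realizationFunctor V).map (homOfLE (h s))

/-- The `p`-th persistent homology, with coefficients in the `R`-module `M`, of a filtration: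
the diagram of singular homology groups `H_p(|K s|; M)`, `s : ℝ`, connected by the maps that are
induced by the inclusions. -/
def persistentHomology {V : Type} [Fintype V] (R : Type u) [Ring R] (M : Type u)
    [AddCommGroup M] [Module R M] (p : ℕ) (K : ℝ →o PreAbstractSimplicialComplex V) :
    ℝ ⥤ ModuleCat.{u} R :=
  filtrationFunctor K ⋙
    (AlgebraicTopology.singularHomologyFunctor (ModuleCat.{u} R) p).obj (ModuleCat.of R M)

/-- The natural transformation of persistent homology induced by inclusions `K s ⊆ L s`. -/
def persistentHomologyMap {V : Type} [Fintype V] (R : Type u) [Ring R] (M : Type u)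
    [AddCommGroup M] [Module R M] (p : ℕ) {K L : ℝ →o PreAbstractSimplicialComplex V}
    (h : K ≤ L) : persistentHomology R M p K ⟶ persistentHomology R M p L :=
  Functor.whiskerRight (filtrationInclusion h)
    ((AlgebraicTopology.singularHomologyFunctor (ModuleCat.{u} R) p).obj (ModuleCat.of R M))

end Complexes

/-! ### Weighted points and spheres

A finite set of weighted points in `ℝⁿ` is a finite set `X` with a weight function `w : X → ℝ`.
The unweighted case is `w = 0`. -/

section Spheres

/-- A sphere in `ℝⁿ`, given by its center and its squared radius, which may be negative. -/
structure WSphere (n : ℕ) where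
  center : EuclideanSpace ℝ (Fin n)
  sqRadius : ℝ

variable {n : ℕ} {X : Finset (EuclideanSpace ℝ (Fin n))}

/-- `S` includes the weighted point `x`. -/
def WSphere.Includes (S : WSphere n) (w : X → ℝ) (x : X) : Prop :=
  dist S.center (x : EuclideanSpace ℝ (Fin n)) ^ 2 ≤ S.sqRadius + w x

/-- `S` excludes the weighted point `x`. -/
def WSphere.Excludes (S : WSphere n) (w : X → ℝ) (x : X) : Prop :=
  S.sqRadius + w x ≤ dist S.center (x : EuclideanSpace ℝ (Fin n)) ^ 2

/-- The weighted point `x` lies on `S`. -/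
def WSphere.LiesOn (S : WSphere n) (w : X → ℝ) (x : X) : Prop :=
  S.Includes w x ∧ S.Excludes w x

/-- `S` is the smallest circumsphere of `Q`. -/
def IsSmallestCircumsphere (w : X → ℝ) (Q : Finset X) (S : WSphere n) : Prop :=
  (∀ q ∈ Q, S.LiesOn w q) ∧
    ∀ T : WSphere n, (∀ q ∈ Q, T.LiesOn w q) → S.sqRadius ≤ T.sqRadius

/-- General position of the weighted points `X`: every `Q ⊆ X` of at most `n + 1` points is
affinely independent, and no point of `X \ Q` lies on the smallest circumsphere of `Q`. -/
def InGeneralPosition (w : X → ℝ) : Prop :=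
  ∀ Q : Finset X, Q.card ≤ n + 1 →
    AffineIndependent ℝ (fun q : Q => ((q : X) : EuclideanSpace ℝ (Fin n))) ∧
    ∀ S : WSphere n, IsSmallestCircumsphere w Q S → ∀ x : X, x ∉ Q → ¬ S.LiesOn w x

end Spheres

/-! ### Čech, Delaunay–Čech and Delaunay filtrations

All filtrations are indexed by the squared radius `s : ℝ`. -/

section Filtrations

variable {n : ℕ} {X : Finset (EuclideanSpace ℝ (Fin n))}

/-- The ball of squared radius `s + w x` centered at `x` (empty if this is negative). -/
def ball (w : X → ℝ) (s : ℝ) (x : X) : Set (EuclideanSpace ℝ (Fin n)) :=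
  {y | dist y (x : EuclideanSpace ℝ (Fin n)) ^ 2 ≤ s + w x}

/-- The (weighted) Voronoi domain of `x`. -/
def voronoi (w : X → ℝ) (x : X) : Set (EuclideanSpace ℝ (Fin n)) :=
  {y | ∀ p : X, dist y (x : EuclideanSpace ℝ (Fin n)) ^ 2 - w x ≤
    dist y (p : EuclideanSpace ℝ (Fin n)) ^ 2 - w p}

theorem ball_mono (w : X → ℝ) {s t : ℝ} (h : s ≤ t) (x : X) : ball w s x ⊆ ball w t x :=
  fun _ hy => le_trans hy (add_le_add_left h _)

/-- The nerve of a family of sets indexed by `V`. -/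
def nerve {V Y : Type} (U : V → Set Y) : PreAbstractSimplicialComplex V where
  faces := {Q | Q.Nonempty ∧ (⋂ x ∈ Q, U x).Nonempty}
  isRelLowerSet_faces := by
    rintro Q ⟨hQ, y, hy⟩
    refine ⟨hQ, fun P hPQ hP => ⟨hP, y, ?_⟩⟩
    simp only [Set.mem_iInter] at hy ⊢
    exact fun x hx => hy x (hPQ hx)

theorem nerve_mono {V Y : Type} {U U' : V → Set Y} (h : ∀ x, U x ⊆ U' x) :
    nerve U ≤ nerve U' :=
  fun _ hQ => ⟨hQ.1, hQ.2.mono (Set.iInter₂_mono fun x _ => h x)⟩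

/-- The Čech filtration. -/
def cech (w : X → ℝ) : ℝ →o PreAbstractSimplicialComplex X where
  toFun s := nerve (ball w s)
  monotone' _ _ h := nerve_mono (ball_mono w h)

/-- The Delaunay triangulation (as an abstract simplicial complex). -/
def delaunayTriangulation (w : X → ℝ) : PreAbstractSimplicialComplex X :=
  nerve (voronoi w)

/-- The Delaunay–Čech filtration: the restriction of the Čech complexes to the Delaunay
triangulation. -/
def delaunayCech (w : X → ℝ) : ℝ →o PreAbstractSimplicialComplex X where
  toFun s := delaunayTriangulation w ⊓ cech w s
  monotone' _ _ h := inf_le_inf_left _ ((cech w).monotone h)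

/-- The Delaunay filtration (alpha complexes): nerves of the Voronoi balls. -/
def delaunay (w : X → ℝ) : ℝ →o PreAbstractSimplicialComplex X where
  toFun s := nerve fun x => ball w s x ∩ voronoi w x
  monotone' _ _ h := nerve_mono fun x => Set.inter_subset_inter_left _ (ball_mono w h x)

end Filtrations

/-! ### The Wrap filtration -/

section Wrap

variable {n : ℕ} {X : Finset (EuclideanSpace ℝ (Fin n))}

/-- `S` is the Delaunay sphere of `Q`: the smallest sphere that includes `Q` and excludes `X`.
Its squared radius is the value of the Delaunay radius function at `Q`. -/
def IsDelaunaySphere (w : X → ℝ) (Q : Finset X) (S : WSphere n) : Prop :=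
  ((∀ q ∈ Q, S.Includes w q) ∧ ∀ x : X, S.Excludes w x) ∧
    ∀ T : WSphere n, ((∀ q ∈ Q, T.Includes w q) ∧ ∀ x : X, T.Excludes w x) →
      S.sqRadius ≤ T.sqRadius

open Classical in
/-- The set of points of `X` that lie on `S`. -/
def onSet (w : X → ℝ) (S : WSphere n) : Finset X :=
  {x | S.LiesOn w x}

/-- `ρ` writes the center of `S` as an affine combination of the points that lie on `S`. -/
def IsCenterCombination (w : X → ℝ) (S : WSphere n) (ρ : X → ℝ) : Prop :=
  (∀ x, x ∉ onSet w S → ρ x = 0) ∧ ∑ x, ρ x = 1 ∧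
    ∑ x, ρ x • (x : EuclideanSpace ℝ (Fin n)) = S.center

open Classical in
/-- The front face of `S`: the points on `S` that have a positive coefficient in the affine
combination of the center. (In general position this combination is unique.) -/
def front (w : X → ℝ) (S : WSphere n) : Finset X :=
  {x ∈ onSet w S | ∃ ρ, IsCenterCombination w S ρ ∧ 0 < ρ x}

/-- The generalized discrete gradient of the Delaunay radius function: all intervals
`[front S, on S]` over the Delaunay spheres `S` of simplices of the Delaunay triangulation. -/
def delaunayGradient (w : X → ℝ) : Set (Set (Finset X)) :=
  {I | ∃ Q ∈ (delaunayTriangulation w).faces, ∃ S, IsDelaunaySphere w Q S ∧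
    I = Set.Icc (front w S) (onSet w S)}

/-- The arcs of the directed graph on the intervals of the gradient. -/
def Arc (w : X → ℝ) (μ ν : Set (Finset X)) : Prop :=
  μ ∈ delaunayGradient w ∧ ν ∈ delaunayGradient w ∧ ∃ P ∈ μ, ∃ Q ∈ ν, P ⊆ Q

/-- The lower set of `A`: the intervals from which `A` can be reached along directed paths. -/
def lowerSet (w : X → ℝ) (A : Set (Set (Finset X))) : Set (Set (Finset X)) :=
  {μ | μ ∈ delaunayGradient w ∧ ∃ ν ∈ A, Relation.ReflTransGen (Arc w) μ ν}

/-- The singular intervals `[Q, Q]` of the gradient for which the Delaunay radius function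
takes at `Q` a value at most `s`. -/
def singularIntervals (w : X → ℝ) (s : ℝ) : Set (Set (Finset X)) :=
  {I | I ∈ delaunayGradient w ∧ ∃ Q, I = Set.Icc Q Q ∧
    ∃ S, IsDelaunaySphere w Q S ∧ S.sqRadius ≤ s}

/-- The simplices of the Wrap complex: the union of the lower set of the singular intervals of
value at most `s`. -/
def wrapSimplices (w : X → ℝ) (s : ℝ) : Set (Finset X) :=
  ⋃₀ lowerSet w (singularIntervals w s)

theorem wrapSimplices_mono (w : X → ℝ) {s t : ℝ} (h : s ≤ t) :
    wrapSimplices w s ⊆ wrapSimplices w t := by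
  rintro Q ⟨μ, ⟨hμ, ν, ⟨hν, R, hR, S, hS, hs⟩, hp⟩, hQ⟩
  exact ⟨μ, ⟨hμ, ν, ⟨hν, R, hR, S, hS, hs.trans h⟩, hp⟩, hQ⟩

/-- The simplicial complex generated by a family of finite sets: all their nonempty subsets. -/
def generatedComplex {V : Type} (A : Set (Finset V)) : PreAbstractSimplicialComplex V where
  faces := {P | P.Nonempty ∧ ∃ Q ∈ A, P ⊆ Q}
  isRelLowerSet_faces := by
    rintro P ⟨hP, Q, hQ, hPQ⟩
    exact ⟨hP, fun P' hP' hne => ⟨hne, Q, hQ, subset_trans hP' hPQ⟩⟩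

/-- The Wrap filtration. For points in general position the generated complex adds nothing to
the set `wrapSimplices w s`, which is then itself a simplicial complex. -/
def wrap (w : X → ℝ) : ℝ →o PreAbstractSimplicialComplex X where
  toFun s := generatedComplex (wrapSimplices w s)
  monotone' _ _ h := by
    rintro P ⟨hP, Q, hQ, hPQ⟩
    exact ⟨hP, Q, wrapSimplices_mono w h hQ, hPQ⟩

end Wrap

end WeightedDelaunay

end

namespace WeightedDelaunay

/-! ### Elementary collapses are homology isomorphisms -/

section Homology

/-! All the complexes are governed by one object: the smallest sphere that includes `Q` and excludes
`E`. With `E` empty its squared radius bounds membership in the Čech complex; with `E` all of `X` it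
is the Delaunay radius. In the coordinates (z, ‖z‖² - s) of a sphere with center z and squared
radius s, the powers of the points are affine and the squared radius is convex, so this is a convex
program. Farkas' lemma yields Karush–Kuhn–Tucker multipliers (`IsLeastSphere.exists_isMultiplier`):
an affine combination of points on the sphere that gives its center, positive only on `Q` and
negative only on `E`. They make the sphere unique and show which points can be added to or removed
from `Q` without changing it.

Each collapse comes from an acyclic matching (`collapses_of_matching`) that toggles one vertex `x`
of `Q`, where `x` depends only on data that the toggle preserves; a monotone function that
determines these data along inclusions rules out cycles.

From Čech to Delaunay–Čech, a simplex outside the Delaunay triangulation has a shortest Farkas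
certificate against the existence of an empty sphere; `x` is a point with negative coefficient
strictly inside the Čech sphere. From Delaunay–Čech to Delaunay, the Čech sphere is smaller than the
Delaunay sphere, and comparing the two through the multipliers gives a point with negative
coefficient for the latter that is strictly inside the former. From Delaunay to Wrap, `x` is any
point of a nonsingular interval that is on the sphere but not in its front face.

Finally an elementary collapse is a strong deformation retraction of realizations, so every
inclusion is an isomorphism in homology at each `s`, hence an isomorphism of diagrams. -/

theorem isIso_map_of_retract {C D : Type*} [Category C] [Category D] (F : C ⥤ D) {X Y : C}
    (i : X ⟶ Y) (r : Y ⟶ X) (hir : i ≫ r = 𝟙 X) (hri : F.map (𝟙 Y) = F.map (r ≫ i)) :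
    IsIso (F.map i) :=
  ⟨F.map r, by rw [← F.map_comp, hir, F.map_id], by rw [← F.map_comp, ← hri, F.map_id]⟩

/-- A section of a homotopy retraction induces isomorphisms in singular homology. -/
theorem isIso_singularHomology_of_retract {X Y : TopCat.{0}} (i : X ⟶ Y) (r : Y ⟶ X)
    (hir : i ≫ r = 𝟙 X) (H : TopCat.Homotopy (𝟙 Y) (r ≫ i)) (R : Type u) [Ring R] (M : Type u)
    [AddCommGroup M] [Module R M] (p : ℕ) :
    IsIso (((AlgebraicTopology.singularHomologyFunctor (ModuleCat.{u} R) p).obj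
      (ModuleCat.of R M)).map i) :=
  isIso_map_of_retract _ i r hir
    (H.congr_homologyMap_singularChainComplexFunctor (ModuleCat.of R M) p)

variable {V : Type}

/-- Push the mass `t * min_σ f` of each vertex of `σ` to the vertex `v`. -/
def pushMass [DecidableEq V] (σ : Finset V) (hσ : σ.Nonempty) (v : V) (t : ℝ) (f : V → ℝ) : V → ℝ :=
  fun u => f u + t * σ.inf' hσ f * ((if u = v then (σ.card : ℝ) else 0) - if u ∈ σ then 1 else 0)

theorem continuous_pushMass [DecidableEq V] (σ : Finset V) (hσ : σ.Nonempty) (v : V) :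
    Continuous fun p : ℝ × (V → ℝ) => pushMass σ hσ v p.1 p.2 := by
  have hm : Continuous fun p : ℝ × (V → ℝ) => σ.inf' hσ p.2 :=
    Continuous.finset_inf'_apply hσ fun i _ => (continuous_apply i).comp continuous_snd
  refine continuous_pi fun u => ?_
  simp only [pushMass]
  fun_prop

theorem pushMass_nonneg [DecidableEq V] {σ : Finset V} (hσ : σ.Nonempty) {v : V} {t : ℝ}
    {f : V → ℝ} (hf : ∀ u, 0 ≤ f u) (ht0 : 0 ≤ t) (ht1 : t ≤ 1) (u : V) :
    0 ≤ pushMass σ hσ v t f u := by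
  have hm : 0 ≤ σ.inf' hσ f := (Finset.le_inf'_iff _ _).2 fun i _ => hf i
  have h1 : 0 ≤ t * σ.inf' hσ f * (if u = v then (σ.card : ℝ) else 0) :=
    mul_nonneg (mul_nonneg ht0 hm) (by split_ifs <;> positivity)
  have h2 : t * σ.inf' hσ f * (if u ∈ σ then 1 else 0) ≤ f u := by
    split_ifs with h
    · have := Finset.inf'_le f h
      nlinarith
    · simpa using hf u
  rw [pushMass, mul_sub]
  linarith

variable [Fintype V]

theorem support_mem_faces {K : PreAbstractSimplicialComplex V} {f : V → ℝ}
    (hf : f ∈ realization K) {S : Finset V} (hS : ∀ v, v ∈ S ↔ f v ≠ 0) : S ∈ K.faces := by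
  obtain ⟨⟨h0, h1⟩, σ, hσ, hv⟩ := hf
  refine (K.isRelLowerSet_faces hσ).2 (fun v hvS => ?_) ?_
  · by_contra h
    exact (hS v).1 hvS (hv v h)
  · by_contra h
    rw [Finset.not_nonempty_iff_eq_empty] at h
    have : ∀ v, f v = 0 := fun v => by
      by_contra h'
      simpa [h] using (hS v).2 h'
    simp [this] at h1

theorem sum_pushMass [DecidableEq V] (σ : Finset V) (hσ : σ.Nonempty) (v : V) (t : ℝ) (f : V → ℝ) :
    ∑ u, pushMass σ hσ v t f u = ∑ u, f u := by
  simp [pushMass, Finset.sum_add_distrib, ← Finset.mul_sum, Finset.sum_sub_distrib]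

/-- A face `σ` with a unique proper coface `σ ∪ {v}` is pushed into the rest of the complex. -/
theorem isIso_of_elementaryCollapse {K L : PreAbstractSimplicialComplex V}
    (hKL : ElementaryCollapse K L) (h : L ≤ K) (R : Type u) [Ring R] (M : Type u)
    [AddCommGroup M] [Module R M] (p : ℕ) :
    IsIso (((AlgebraicTopology.singularHomologyFunctor (ModuleCat.{u} R) p).obj
      (ModuleCat.of R M)).map ((realizationFunctor V).map (homOfLE h))) := by
  classical
  obtain ⟨σ, hσ, τ, hτ, hστ, hcard, hcof, hL⟩ := hKL
  have hne : σ.Nonempty := (K.isRelLowerSet_faces hσ).1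
  obtain ⟨v, hvσ, rfl⟩ : ∃ v, v ∉ σ ∧ insert v σ = τ := by
    obtain ⟨v, hv⟩ := Finset.card_eq_one.1 (show (τ \ σ).card = 1 by
      rw [Finset.card_sdiff_of_subset hστ.subset]; omega)
    have hv' : v ∈ τ \ σ := hv ▸ Finset.mem_singleton_self v
    refine ⟨v, (Finset.mem_sdiff.1 hv').2, ?_⟩
    rw [← Finset.sdiff_union_of_subset hστ.subset, hv]; rfl
  -- a point of `|K|` is either fixed or lies in the closed simplex `σ ∪ {v}`
  have hcases : ∀ f ∈ realization K, σ.inf' hne f = 0 ∨ ∀ u, u ∉ insert v σ → f u = 0 := by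
    intro f hf
    by_cases hm : σ.inf' hne f = 0
    · exact Or.inl hm
    right
    have hpos : ∀ u ∈ σ, f u ≠ 0 := fun u hu h0 => hm (le_antisymm
      (h0 ▸ Finset.inf'_le f hu) ((Finset.le_inf'_iff _ _).2 fun i _ => hf.1.1 i))
    have hS := support_mem_faces hf (S := {u | f u ≠ 0}) (by simp)
    have hσS : σ ⊆ ({u | f u ≠ 0} : Finset V) := fun u hu => by simpa using hpos u hu
    intro u hu
    by_contra hfu
    have huS : u ∈ ({u | f u ≠ 0} : Finset V) := by simpa using hfu
    rcases hσS.eq_or_ssubset with h' | h'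
    · exact hu (Finset.mem_insert_of_mem (h' ▸ huS))
    · exact hu (hcof _ hS h' ▸ huS)
  have hfix : ∀ t f, σ.inf' hne f = 0 → pushMass σ hne v t f = f := fun t f hm => by
    ext u; simp [pushMass, hm]
  -- A face containing `σ` is `σ` or `τ`, and both are absent from `L`. So each point of `|L|`
  -- vanishes at some vertex of `σ`, and pushing fixes it.
  have hL0 : ∀ f ∈ realization L, σ.inf' hne f = 0 := by
    intro f hf
    by_contra hm
    obtain ⟨ρ, hρ, hv⟩ := hf.2
    have hσρ : σ ⊆ ρ := fun u hu => by
      by_contra hu'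
      exact hm (le_antisymm ((hv u hu').symm ▸ Finset.inf'_le f hu)
        ((Finset.le_inf'_iff _ _).2 fun i _ => hf.1.1 i))
    rw [hL] at hρ
    rcases hσρ.eq_or_ssubset with h' | h'
    · exact hρ.2 (Or.inl h'.symm)
    · exact hρ.2 (Or.inr (hcof _ hρ.1 h'))
  have hsimp : ∀ f ∈ realization K, ∀ t, 0 ≤ t → t ≤ 1 →
      pushMass σ hne v t f ∈ stdSimplex ℝ V := fun f hf t h0 h1 =>
    ⟨pushMass_nonneg hne hf.1.1 h0 h1, (sum_pushMass ..).trans hf.1.2⟩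
  have hK : ∀ f ∈ realization K, ∀ t, 0 ≤ t → t ≤ 1 → pushMass σ hne v t f ∈ realization K := by
    intro f hf t h0 h1
    rcases hcases f hf with hm | hm
    · rwa [hfix t f hm]
    · refine ⟨hsimp f hf t h0 h1, _, hτ, fun u hu => ?_⟩
      have hu' := hu
      rw [Finset.mem_insert, not_or] at hu'
      simp [pushMass, hm u hu, hu'.1, hu'.2]
  -- At time one a vertex `w` of `σ` with least mass is emptied, and any face of `K` that misses a
  -- vertex of `σ` survives in `L`.
  have hr : ∀ f ∈ realization K, pushMass σ hne v 1 f ∈ realization L := by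
    intro f hf
    have hfL : ∀ ρ ∈ K.faces, ∀ w ∈ σ, w ∉ ρ → ρ ∈ L.faces := by
      intro ρ hρ w hw hwρ
      rw [hL]
      refine ⟨hρ, ?_⟩
      rintro (h' | h')
      · exact hwρ (h' ▸ hw)
      · exact hwρ (Set.mem_singleton_iff.1 h' ▸ Finset.mem_insert_of_mem hw)
    obtain ⟨w, hw, hwm⟩ := σ.exists_mem_eq_inf' hne f
    refine ⟨hsimp f hf 1 zero_le_one le_rfl, ?_⟩
    rcases hcases f hf with hm | hm
    · rw [hfix 1 f hm]
      refine ⟨_, hfL _ (support_mem_faces hf (S := {u | f u ≠ 0}) (by simp)) w hw ?_, by simp⟩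
      simp [← hwm, hm]
    · refine ⟨(insert v σ).erase w, hfL _ ((K.isRelLowerSet_faces hτ).2 (Finset.erase_subset _ _)
        ⟨v, Finset.mem_erase.2 ⟨fun h' => hvσ (h' ▸ hw), Finset.mem_insert_self _ _⟩⟩) w hw
        (Finset.notMem_erase _ _), fun u hu => ?_⟩
      rw [Finset.mem_erase, not_and_or, not_not] at hu
      rcases hu with rfl | hu
      · have : u ≠ v := fun h' => hvσ (h' ▸ hw)
        simp [pushMass, hw, this, hwm]
      · have hu' := hu
        rw [Finset.mem_insert, not_or] at hu'
        simp [pushMass, hm u hu, hu'.1, hu'.2]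
  have hcont : Continuous fun p : unitInterval × realization K =>
      pushMass σ hne v (p.1 : ℝ) (p.2 : V → ℝ) :=
    (continuous_pushMass σ hne v).comp
      (f := fun p : unitInterval × realization K => ((p.1 : ℝ), (p.2 : V → ℝ))) (by fun_prop)
  set i : TopCat.of (realization L) ⟶ TopCat.of (realization K) :=
    (realizationFunctor V).map (homOfLE h) with hi
  let r : TopCat.of (realization K) ⟶ TopCat.of (realization L) := TopCat.ofHom
    ⟨fun f => ⟨pushMass σ hne v 1 f, hr f f.2⟩, by
      refine Continuous.subtype_mk ?_ _
      exact (continuous_pushMass σ hne v).comp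
        (f := fun f : realization K => ((1 : ℝ), (f : V → ℝ))) (by fun_prop)⟩
  have hir : i ≫ r = 𝟙 _ := by
    ext f u
    exact congrFun (hfix 1 f (hL0 f f.2)) u
  let H : TopCat.Homotopy (𝟙 (TopCat.of (realization K))) (r ≫ i) :=
    { toFun := fun p => ⟨pushMass σ hne v (p.1 : ℝ) (p.2 : V → ℝ), hK _ p.2.2 _ p.1.2.1 p.1.2.2⟩
      continuous_toFun := Continuous.subtype_mk hcont _
      map_zero_left := fun f => Subtype.ext (by ext u; simp [pushMass])
      map_one_left := fun f => rfl }
  exact isIso_singularHomology_of_retract i r hir H R M p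

omit [Fintype V] in
theorem Collapses.le {K L : PreAbstractSimplicialComplex V} (h : Collapses K L) : L ≤ K := by
  induction h with
  | refl => exact le_rfl
  | tail _ h ih =>
    obtain ⟨σ, -, τ, -, -, -, -, hL⟩ := h
    refine le_trans (fun Q hQ => ?_) ih
    exact (hL.subset hQ).1

theorem isIso_of_collapses {K L : PreAbstractSimplicialComplex V}
    (hKL : Collapses K L) (h : L ≤ K) (R : Type u) [Ring R] (M : Type u)
    [AddCommGroup M] [Module R M] (p : ℕ) :
    IsIso (((AlgebraicTopology.singularHomologyFunctor (ModuleCat.{u} R) p).obj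
      (ModuleCat.of R M)).map ((realizationFunctor V).map (homOfLE h))) := by
  induction hKL with
  | refl =>
    rw [show homOfLE h = 𝟙 K from rfl]
    infer_instance
  | @tail A B hA hAB ih =>
    have hBA : B ≤ A := Collapses.le (.single hAB)
    have hAK : A ≤ K := Collapses.le hA
    have h1 := ih hAK
    have h2 := isIso_of_elementaryCollapse hAB hBA R M p
    rw [show homOfLE h = homOfLE hBA ≫ homOfLE hAK from rfl, Functor.map_comp, Functor.map_comp]
    exact IsIso.comp_isIso

theorem isIso_persistentHomologyMap {K L : ℝ →o PreAbstractSimplicialComplex V}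
    (hKL : ∀ s, Collapses (K s) (L s)) (h : L ≤ K) (R : Type u) [Ring R] (M : Type u)
    [AddCommGroup M] [Module R M] (p : ℕ) :
    IsIso (persistentHomologyMap R M p h) := by
  have : ∀ s, IsIso ((persistentHomologyMap R M p h).app s) := fun s =>
    isIso_of_collapses (hKL s) (h s) R M p
  exact NatIso.isIso_of_isIso_app _

end Homology

end WeightedDelaunay

namespace WeightedDelaunay

/-! ### Collapses from acyclic matchings -/

section CollapseCriterion

variable {V : Type} [Fintype V] [DecidableEq V]

/-- Collapsing along a matching that toggles the vertex `m Q` of the faces `Q` of `K` outside `L`. -/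
theorem collapses_of_toggle (L : PreAbstractSimplicialComplex V) (g : Finset V → ℝ)
    (m : Finset V → V) (K : PreAbstractSimplicialComplex V) (hLK : L ≤ K)
    (hmatch : ∀ Q ∈ K.faces \ L.faces,
      insert (m Q) Q ∈ K.faces \ L.faces ∧ Q.erase (m Q) ∈ K.faces \ L.faces ∧
        g (insert (m Q) Q) = g (Q.erase (m Q)))
    (hmono : ∀ Q ∈ K.faces \ L.faces, ∀ Q' ∈ K.faces \ L.faces, Q ⊆ Q' → g Q ≤ g Q')
    (hconst : ∀ Q ∈ K.faces \ L.faces, ∀ Q' ∈ K.faces \ L.faces, Q ⊆ Q' → g Q = g Q' →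
      m Q = m Q') :
    Collapses K L := by
  induction hN : (K.faces \ L.faces).ncard using Nat.strong_induction_on generalizing K with
  | _ N ih => ?_
  by_cases hKL : K.faces \ L.faces = ∅
  · have : K = L := le_antisymm (Set.sdiff_eq_empty.1 hKL) hLK
    rw [this]
    exact .refl
  obtain ⟨Q₀, hQ₀⟩ := Set.nonempty_iff_ne_empty.2 hKL
  have hg : ∀ Q ∈ K.faces \ L.faces, g (Q.erase (m Q)) = g Q ∧ g (insert (m Q) Q) = g Q := by
    intro Q hQ
    obtain ⟨h1, h2, h3⟩ := hmatch Q hQ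
    have h4 := hmono _ h2 _ hQ (Finset.erase_subset _ _)
    have h5 := hmono _ hQ _ h1 (Finset.subset_insert _ _)
    constructor <;> linarith
  have hme : ∀ Q ∈ K.faces \ L.faces, m (Q.erase (m Q)) = m Q := fun Q hQ =>
    hconst _ (hmatch Q hQ).2.1 _ hQ (Finset.erase_subset _ _) (hg Q hQ).1
  have hmi : ∀ Q ∈ K.faces \ L.faces, m (insert (m Q) Q) = m Q := fun Q hQ =>
    (hconst _ hQ _ (hmatch Q hQ).1 (Finset.subset_insert _ _) (hg Q hQ).2.symm).symm
  -- a lexicographically maximal face that misses its vertex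
  obtain ⟨σ, hσ, hmax⟩ := (Set.toFinite {Q | Q ∈ K.faces \ L.faces ∧ m Q ∉ Q}).exists_maximalFor
    (fun Q => toLex (g Q, Q.card)) _ ⟨Q₀.erase (m Q₀), (hmatch _ hQ₀).2.1, by
      rw [hme Q₀ hQ₀]; exact Finset.notMem_erase _ _⟩
  obtain ⟨hσD, hσm⟩ := hσ
  set τ := insert (m σ) σ with hτ
  have hτD : τ ∈ K.faces \ L.faces := (hmatch σ hσD).1
  have hστ : σ ⊂ τ := Finset.ssubset_insert hσm
  have hcof : ∀ ρ ∈ K.faces, σ ⊂ ρ → ρ = τ := by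
    intro ρ hρ hσρ
    have hσne : σ.Nonempty := (K.isRelLowerSet_faces hσD.1).1
    have hρD : ρ ∈ K.faces \ L.faces :=
      ⟨hρ, fun h => hσD.2 ((L.isRelLowerSet_faces h).2 hσρ.subset hσne)⟩
    have h1 := hmono _ hσD _ hρD hσρ.subset
    have hρe : m (ρ.erase (m ρ)) ∉ ρ.erase (m ρ) := by
      rw [hme ρ hρD]; exact Finset.notMem_erase _ _
    have hρeD := (hmatch ρ hρD).2.1
    have hgρ := (hg ρ hρD).1
    -- Otherwise the lower partner of `ρ` would exceed `σ` in the lexicographic order.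
    have key : g ρ = g σ ∧ (ρ.erase (m ρ)).card ≤ σ.card := by
      by_contra hcon
      have hlt : toLex (g σ, σ.card) < toLex (g (ρ.erase (m ρ)), (ρ.erase (m ρ)).card) := by
        rw [Prod.Lex.toLex_lt_toLex]
        simp only [hgρ]
        rcases h1.lt_or_eq with h | h
        · exact Or.inl h
        · refine Or.inr ⟨h, ?_⟩
          by_contra h'
          exact hcon ⟨h.symm, not_lt.1 h'⟩
      exact absurd (hmax ⟨hρeD, hρe⟩ hlt.le) (not_le_of_gt hlt)
    have hmρ : m ρ = m σ :=
      (hconst _ hσD _ hρD hσρ.subset key.1.symm).symm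
    rw [hmρ] at key
    -- On the same level `ρ` toggles the same vertex as `σ`, so `σ` lies in the lower partner of
    -- `ρ`, and the cardinalities force equality.
    have hsub : σ ⊆ ρ.erase (m σ) := fun y hy =>
      Finset.mem_erase.2 ⟨fun h => hσm (h ▸ hy), hσρ.subset hy⟩
    have heq := Finset.eq_of_subset_of_card_le hsub key.2
    have hmem : m σ ∈ ρ := by
      by_contra h
      rw [Finset.erase_eq_of_notMem h] at heq
      exact hσρ.ne heq
    calc ρ = insert (m σ) (ρ.erase (m σ)) := (Finset.insert_erase hmem).symm
      _ = τ := by rw [← heq]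
  -- remove the pair
  let K' : PreAbstractSimplicialComplex V :=
    { faces := K.faces \ {σ, τ}
      isRelLowerSet_faces := by
        rintro Q ⟨hQ, hQn⟩
        refine ⟨(K.isRelLowerSet_faces hQ).1, fun R hR hRne => ⟨(K.isRelLowerSet_faces hQ).2 hR hRne,
          fun hR' => hQn ?_⟩⟩
        have hσR : σ ⊆ R := by
          rcases hR' with h | h
          · exact h.symm.subset
          · rw [Set.mem_singleton_iff.1 h]; exact hστ.subset
        rcases (hσR.trans hR).eq_or_ssubset with h | h
        · exact Or.inl h.symm
        · exact Or.inr (hcof Q hQ h) }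
  have hK'D : ∀ Q, Q ∈ K'.faces \ L.faces ↔ Q ∈ K.faces \ L.faces ∧ Q ≠ σ ∧ Q ≠ τ := by
    intro Q
    simp only [K', Set.mem_sdiff, Set.mem_insert_iff, Set.mem_singleton_iff]
    tauto
  have hstep : ElementaryCollapse K K' :=
    ⟨σ, hσD.1, τ, hτD.1, hστ, Finset.card_insert_of_notMem hσm, hcof, rfl⟩
  have hLK' : L ≤ K' := fun Q hQ => ⟨hLK hQ, by
    rintro (h | h)
    · exact hσD.2 (h ▸ hQ)
    · exact hτD.2 (h ▸ hQ)⟩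
  have hsub : ∀ Q, Q ∈ K'.faces \ L.faces → Q ∈ K.faces \ L.faces := fun Q hQ => ((hK'D Q).1 hQ).1
  have hmτ : m τ = m σ := hmi σ hσD
  refine .head hstep (ih _ ?_ K' hLK' ?_ (fun Q hQ Q' hQ' => hmono _ (hsub _ hQ) _ (hsub _ hQ'))
    (fun Q hQ Q' hQ' => hconst _ (hsub _ hQ) _ (hsub _ hQ')) rfl)
  · rw [← hN]
    exact Set.ncard_lt_ncard ⟨hsub, fun h => ((hK'D σ).1 (h hσD)).2.1 rfl⟩
  · intro Q hQ
    obtain ⟨hQD, hQσ, hQτ⟩ := (hK'D Q).1 hQ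
    obtain ⟨h1, h2, h3⟩ := hmatch Q hQD
    -- A face that toggles to `σ` or `τ` would toggle the vertex `m σ` and so be one of these two
    -- itself; hence the remaining faces keep their partners.
    refine ⟨(hK'D _).2 ⟨h1, fun h => ?_, fun h => ?_⟩, (hK'D _).2 ⟨h2, fun h => ?_, fun h => ?_⟩, h3⟩
    · have hmQ : m σ = m Q := h ▸ hmi Q hQD
      exact hσm (hmQ ▸ h ▸ Finset.mem_insert_self _ _)
    · have hmQ : m Q = m σ := (h ▸ hmi Q hQD : m τ = m Q).symm.trans hmτ
      by_cases hmem : m Q ∈ Q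
      · exact hQτ (by rw [← h, Finset.insert_eq_of_mem hmem])
      · refine hQσ ?_
        rw [← Finset.erase_insert hmem, h, hτ, hmQ, Finset.erase_insert hσm]
    · have hmQ : m σ = m Q := h ▸ hme Q hQD
      by_cases hmem : m Q ∈ Q
      · refine hQτ ?_
        rw [← Finset.insert_erase hmem, h, hτ, hmQ]
      · exact hQσ (by rw [← h, Finset.erase_eq_of_notMem hmem])
    · have hmQ : m Q = m σ := (h ▸ hme Q hQD : m τ = m Q).symm.trans hmτ
      have : m σ ∈ Q.erase (m Q) := h ▸ Finset.mem_insert_self _ _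
      rw [hmQ] at this
      exact Finset.notMem_erase _ _ this

/-- A face `Q` of `K` outside `L` is matched by toggling a vertex `x` with `P Q x`. The matching is
acyclic since `g` is monotone and the candidates `x` only change when `g` increases. -/
theorem collapses_of_matching (L : PreAbstractSimplicialComplex V) (g : Finset V → ℝ)
    (P : Finset V → V → Prop) (K : PreAbstractSimplicialComplex V) (hLK : L ≤ K)
    (hex : ∀ Q ∈ K.faces \ L.faces, ∃ x, P Q x)
    (hmatch : ∀ Q ∈ K.faces \ L.faces, ∀ x, P Q x →
      insert x Q ∈ K.faces \ L.faces ∧ Q.erase x ∈ K.faces \ L.faces ∧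
        g (insert x Q) = g (Q.erase x))
    (hmono : ∀ Q ∈ K.faces \ L.faces, ∀ Q' ∈ K.faces \ L.faces, Q ⊆ Q' → g Q ≤ g Q')
    (hconst : ∀ Q ∈ K.faces \ L.faces, ∀ Q' ∈ K.faces \ L.faces, Q ⊆ Q' → g Q = g Q' →
      P Q = P Q') :
    Collapses K L := by
  by_cases hKL : K.faces \ L.faces = ∅
  · have : K = L := le_antisymm (Set.sdiff_eq_empty.1 hKL) hLK
    rw [this]
    exact .refl
  obtain ⟨Q₀, hQ₀⟩ := Set.nonempty_iff_ne_empty.2 hKL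
  obtain ⟨x₀, -⟩ := hex Q₀ hQ₀
  classical
  -- Choosing from the predicate, not from the face, makes the vertex depend on `P Q` alone. The
  -- default `x₀` is never taken on a face outside `L`.
  let c : (V → Prop) → V := fun p => if h : ∃ x, p x then h.choose else x₀
  refine collapses_of_toggle L g (fun Q => c (P Q)) K hLK (fun Q hQ => ?_) hmono
    (fun Q hQ Q' hQ' h h' => congrArg c (hconst Q hQ Q' hQ' h h'))
  refine hmatch Q hQ _ ?_
  simp only [c, dif_pos (hex Q hQ)]
  exact (hex Q hQ).choose_spec

end CollapseCriterion

end WeightedDelaunay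

namespace WeightedDelaunay

/-! ### Farkas' lemma -/

section Farkas

variable {ι W : Type*} [AddCommGroup W] [Module ℝ W]

/-- Farkas' lemma for finitely many linear functionals. -/
theorem exists_nonneg_combination [DecidableEq ι] (s : Finset ι) (a : ι → W →ₗ[ℝ] ℝ)
    (b : W →ₗ[ℝ] ℝ) (h : ∀ x, (∀ i ∈ s, a i x ≤ 0) → b x ≤ 0) :
    ∃ c : ι → ℝ, (∀ i, 0 ≤ c i) ∧ b = ∑ i ∈ s, c i • a i := by
  induction s using Finset.induction_on generalizing a b with
  | empty =>
    refine ⟨0, fun _ => le_rfl, LinearMap.ext fun x => ?_⟩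
    have h1 := h x (by simp)
    have h2 := h (-x) (by simp)
    rw [map_neg] at h2
    simp only [Finset.sum_empty, LinearMap.zero_apply]
    linarith
  | insert j s hj ih =>
    have hite : ∀ (c : ι → ℝ) (d : ℝ),
        ∑ i ∈ s, (if i = j then d else c i) • a i = ∑ i ∈ s, c i • a i := fun c d =>
      Finset.sum_congr rfl fun i hi => by
        rw [if_neg (show ¬ i = j from fun h' => hj (h' ▸ hi))]
    by_cases hs : ∀ x, (∀ i ∈ s, a i x ≤ 0) → b x ≤ 0
    · obtain ⟨c, hc, hb⟩ := ih a b hs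
      refine ⟨fun i => if i = j then 0 else c i, fun i => ?_, ?_⟩
      · dsimp only; split_ifs
        · exact le_rfl
        · exact hc i
      · simp only [Finset.sum_insert hj, if_true, zero_smul, zero_add, hite, hb]
    push Not at hs
    obtain ⟨y, hy, hby⟩ := hs
    have hjy : 0 < a j y := by
      by_contra hcon
      refine absurd (h y fun i hi => ?_) (not_le.2 hby)
      rcases Finset.mem_insert.1 hi with rfl | hi
      · exact not_lt.1 hcon
      · exact hy i hi
    -- the functionals composed with the projection along `y` onto the kernel of `a j`
    obtain ⟨c, hc, hb⟩ := ih (fun i => a i - (a i y / a j y) • a j) (b - (b y / a j y) • a j)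
      fun x hx => by
        have key : ∀ f : W →ₗ[ℝ] ℝ,
            f (x - (a j x / a j y) • y) = (f - (f y / a j y) • a j) x := fun f => by
          simp only [map_sub, map_smul, smul_eq_mul, LinearMap.sub_apply, LinearMap.smul_apply]
          ring
        rw [← key]
        refine h _ fun i hi => ?_
        rcases Finset.mem_insert.1 hi with rfl | hi
        · rw [key]
          simp [hjy.ne']
        · rw [key]
          exact hx i hi
    -- The new coefficient of `a j` is nonnegative because `y` violates only the constraint `j`: `b`
    -- and `a j` are positive there, the other functionals nonpositive.
    have hd : 0 ≤ b y / a j y - ∑ i ∈ s, c i * (a i y / a j y) := by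
      have h1 : ∑ i ∈ s, c i * (a i y / a j y) ≤ 0 := Finset.sum_nonpos fun i hi =>
        mul_nonpos_of_nonneg_of_nonpos (hc i) (div_nonpos_of_nonpos_of_nonneg (hy i hi) hjy.le)
      have h2 : 0 ≤ b y / a j y := by positivity
      linarith
    refine ⟨fun i => if i = j then b y / a j y - ∑ i ∈ s, c i * (a i y / a j y) else c i,
      fun i => ?_, ?_⟩
    · dsimp only; split_ifs
      · exact hd
      · exact hc i
    · refine LinearMap.ext fun x => ?_
      have h1 := LinearMap.congr_fun hb x
      simp only [LinearMap.sub_apply, LinearMap.smul_apply, LinearMap.sum_apply, smul_eq_mul,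
        mul_sub, Finset.sum_sub_distrib] at h1
      have h2 : ∑ i ∈ s, c i * (a i y / a j y * a j x) =
          (∑ i ∈ s, c i * (a i y / a j y)) * a j x := by
        rw [Finset.sum_mul]; exact Finset.sum_congr rfl fun i _ => by ring
      simp only [Finset.sum_insert hj, if_true, hite, LinearMap.add_apply, LinearMap.smul_apply,
        LinearMap.sum_apply, smul_eq_mul]
      rw [h2] at h1
      linarith

/-- Farkas' lemma for functionals that are required to be nonpositive on `A` and nonnegative
on `B`. -/
theorem exists_signed_combination [Fintype ι] [DecidableEq ι] (A B : Finset ι)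
    (a : ι → W →ₗ[ℝ] ℝ) (b : W →ₗ[ℝ] ℝ)
    (h : ∀ x, (∀ i ∈ A, a i x ≤ 0) → (∀ i ∈ B, 0 ≤ a i x) → b x ≤ 0) :
    ∃ ρ : ι → ℝ, (∀ i, 0 < ρ i → i ∈ A) ∧ (∀ i, ρ i < 0 → i ∈ B) ∧ b = ∑ i, ρ i • a i := by
  obtain ⟨c, hc, hb⟩ := exists_nonneg_combination (A.disjSum B) (Sum.elim a fun i => -a i) b
    fun x hx => h x (fun i hi => hx (.inl i) (by simpa using hi)) fun i hi => by
      simpa using hx (.inr i) (by simpa using hi)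
  refine ⟨fun i => (if i ∈ A then c (.inl i) else 0) - if i ∈ B then c (.inr i) else 0,
    fun i hi => ?_, fun i hi => ?_, ?_⟩
  · by_contra hiA
    have := hc (.inr i)
    dsimp only at hi
    rw [if_neg hiA] at hi
    split_ifs at hi <;> linarith
  · by_contra hiB
    have := hc (.inl i)
    dsimp only at hi
    rw [if_neg hiB] at hi
    split_ifs at hi <;> linarith
  · refine LinearMap.ext fun x => ?_
    rw [hb, Finset.sum_disjSum]
    simp [sub_mul, Finset.sum_sub_distrib, LinearMap.sum_apply, ← sub_eq_add_neg]

end Farkas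

/-! ### Smallest separating spheres and their multipliers -/

section LeastSpheres

variable {n : ℕ} {X : Finset (EuclideanSpace ℝ (Fin n))} {w : X → ℝ}

/-- The power of the weighted point `x` with respect to the sphere `S`. -/
noncomputable def WSphere.power (S : WSphere n) (w : X → ℝ) (x : X) : ℝ :=
  dist S.center (x : EuclideanSpace ℝ (Fin n)) ^ 2 - S.sqRadius - w x

theorem WSphere.includes_iff {S : WSphere n} {x : X} : S.Includes w x ↔ S.power w x ≤ 0 := by
  rw [WSphere.Includes, WSphere.power]
  constructor <;> intro h <;> linarith

theorem WSphere.excludes_iff {S : WSphere n} {x : X} : S.Excludes w x ↔ 0 ≤ S.power w x := by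
  rw [WSphere.Excludes, WSphere.power]
  constructor <;> intro h <;> linarith

theorem WSphere.liesOn_iff {S : WSphere n} {x : X} : S.LiesOn w x ↔ S.power w x = 0 := by
  rw [WSphere.LiesOn, includes_iff, excludes_iff, le_antisymm_iff]

theorem mem_onSet {S : WSphere n} {x : X} : x ∈ onSet w S ↔ S.power w x = 0 := by
  rw [← WSphere.liesOn_iff]
  simp [onSet]

open scoped RealInnerProductSpace

theorem WSphere.power_eq (S : WSphere n) (x : X) :
    S.power w x = ‖(x : EuclideanSpace ℝ (Fin n))‖ ^ 2 - w x
      - 2 * ⟪S.center, (x : EuclideanSpace ℝ (Fin n))⟫ + (‖S.center‖ ^ 2 - S.sqRadius) := by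
  rw [WSphere.power, dist_eq_norm, norm_sub_sq_real]
  ring

/-- `S` includes the points of `Q` and excludes those of `E`. -/
def Separates (w : X → ℝ) (Q : Finset X) (E : Set X) (S : WSphere n) : Prop :=
  (∀ q ∈ Q, S.Includes w q) ∧ ∀ x ∈ E, S.Excludes w x

/-- `S` is the smallest sphere that includes `Q` and excludes `E`. -/
def IsLeastSphere (w : X → ℝ) (Q : Finset X) (E : Set X) (S : WSphere n) : Prop :=
  Separates w Q E S ∧ ∀ T, Separates w Q E T → S.sqRadius ≤ T.sqRadius

theorem isDelaunaySphere_iff {Q : Finset X} {S : WSphere n} :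
    IsDelaunaySphere w Q S ↔ IsLeastSphere w Q Set.univ S := by
  simp [IsDelaunaySphere, IsLeastSphere, Separates]

/-- `ρ` certifies that `S` is the smallest sphere that includes `Q` and excludes `E`. -/
def IsMultiplier (w : X → ℝ) (Q : Finset X) (E : Set X) (S : WSphere n) (ρ : X → ℝ) : Prop :=
  IsCenterCombination w S ρ ∧ (∀ x, 0 < ρ x → x ∈ Q) ∧ ∀ x, ρ x < 0 → x ∈ E

/-- Powers are affine in the point up to the term ‖x‖² - `w x`, which cancels in the difference.
Affine weights with barycenter `S.center` turn the rest into a completed square. This identity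
drives every comparison of two spheres below. -/
theorem sum_mul_power {S : WSphere n} {ρ : X → ℝ} (h1 : ∑ x, ρ x = 1)
    (hc : ∑ x, ρ x • (x : EuclideanSpace ℝ (Fin n)) = S.center) (T : WSphere n) :
    ∑ x, ρ x * T.power w x - ∑ x, ρ x * S.power w x
      = dist T.center S.center ^ 2 - T.sqRadius + S.sqRadius := by
  have hin : ∀ v : EuclideanSpace ℝ (Fin n),
      ∑ x, ρ x * ⟪v, (x : EuclideanSpace ℝ (Fin n))⟫ = ⟪v, S.center⟫ := fun v => by
    rw [← hc, inner_sum]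
    simp [inner_smul_right]
  have : ∀ x, ρ x * T.power w x - ρ x * S.power w x =
      ρ x * (‖T.center‖ ^ 2 - T.sqRadius - (‖S.center‖ ^ 2 - S.sqRadius))
      - 2 * (ρ x * ⟪T.center, (x : EuclideanSpace ℝ (Fin n))⟫)
      + 2 * (ρ x * ⟪S.center, (x : EuclideanSpace ℝ (Fin n))⟫) := fun x => by
    rw [T.power_eq, S.power_eq]; ring
  rw [← Finset.sum_sub_distrib, Finset.sum_congr rfl fun x _ => this x, Finset.sum_add_distrib,
    Finset.sum_sub_distrib, ← Finset.sum_mul, ← Finset.mul_sum, ← Finset.mul_sum, hin, hin, h1,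
    dist_eq_norm, norm_sub_sq_real, real_inner_self_eq_norm_sq]
  ring

theorem IsCenterCombination.sum_mul_power_eq_zero {S : WSphere n} {ρ : X → ℝ}
    (h : IsCenterCombination w S ρ) : ∑ x, ρ x * S.power w x = 0 :=
  Finset.sum_eq_zero fun x _ => by
    by_cases hx : x ∈ onSet w S
    · rw [mem_onSet.1 hx, mul_zero]
    · rw [h.1 x hx, zero_mul]

/-- Multipliers give more than minimality: the squared radius of a competitor grows at least by the
squared distance of the centers, which also forces uniqueness. -/
theorem IsMultiplier.sq_dist_add_le {Q : Finset X} {E : Set X} {S T : WSphere n} {ρ : X → ℝ}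
    (h : IsMultiplier w Q E S ρ) (hT : Separates w Q E T) :
    dist T.center S.center ^ 2 + S.sqRadius ≤ T.sqRadius := by
  have h1 := sum_mul_power (w := w) h.1.2.1 h.1.2.2 T
  rw [h.1.sum_mul_power_eq_zero] at h1
  have h2 : ∑ x, ρ x * T.power w x ≤ 0 := Finset.sum_nonpos fun x _ => by
    rcases lt_trichotomy (ρ x) 0 with hx | hx | hx
    · exact mul_nonpos_of_nonpos_of_nonneg hx.le (WSphere.excludes_iff.1 (hT.2 x (h.2.2 x hx)))
    · simp [hx]
    · exact mul_nonpos_of_nonneg_of_nonpos hx.le (WSphere.includes_iff.1 (hT.1 x (h.2.1 x hx)))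
  linarith

theorem IsMultiplier.isLeastSphere {Q : Finset X} {E : Set X} {S : WSphere n} {ρ : X → ℝ}
    (h : IsMultiplier w Q E S ρ) (hS : Separates w Q E S) : IsLeastSphere w Q E S :=
  ⟨hS, fun T hT => by nlinarith [h.sq_dist_add_le hT, sq_nonneg (dist T.center S.center)]⟩

theorem IsMultiplier.nonempty {Q : Finset X} {E : Set X} {S : WSphere n} {ρ : X → ℝ}
    (h : IsMultiplier w Q E S ρ) : Q.Nonempty := by
  obtain ⟨x, -, hx⟩ : ∃ x ∈ Finset.univ, 0 < ρ x := by
    by_contra! hcon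
    linarith [h.1.2.1, Finset.sum_nonpos hcon]
  exact ⟨x, h.2.1 x hx⟩

/-- The Karush–Kuhn–Tucker conditions for smallest separating spheres. -/
theorem IsLeastSphere.exists_isMultiplier {Q : Finset X} {E : Set X} {S : WSphere n}
    (h : IsLeastSphere w Q E S) : ∃ ρ, IsMultiplier w Q E S ρ := by
  classical
  -- In the coordinates (z, ‖z‖² - s), `a x` is the derivative of the power of `x` and `b` is minus
  -- the derivative of the squared radius at `S`. A direction with `b` positive that respects the
  -- active constraints would lead to a smaller separating sphere.
  let a : X → (EuclideanSpace ℝ (Fin n) × ℝ) →ₗ[ℝ] ℝ := fun x =>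
    LinearMap.coprod ((-2 : ℝ) • (innerₛₗ ℝ (x : EuclideanSpace ℝ (Fin n)))) LinearMap.id
  let b : (EuclideanSpace ℝ (Fin n) × ℝ) →ₗ[ℝ] ℝ :=
    LinearMap.coprod ((-2 : ℝ) • (innerₛₗ ℝ S.center)) LinearMap.id
  obtain ⟨ρ, hA, hB, hb⟩ := exists_signed_combination
    (Finset.univ.filter fun x => x ∈ onSet w S ∧ x ∈ Q)
    (Finset.univ.filter fun x => x ∈ onSet w S ∧ x ∈ E) a b (by
      rintro ⟨v, α⟩ hQ hE
      by_contra hcon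
      simp only [a, b, Finset.mem_filter, Finset.mem_univ, true_and, LinearMap.coprod_apply,
        LinearMap.smul_apply, innerₛₗ_apply_apply, smul_eq_mul, LinearMap.id_apply, not_le]
        at hQ hE hcon
      let T : ℝ → WSphere n := fun ε => ⟨S.center + ε • v,
        ‖S.center + ε • v‖ ^ 2 - (‖S.center‖ ^ 2 - S.sqRadius + ε * α)⟩
      have hpow : ∀ ε x, (T ε).power w x = S.power w x
          + ε * (-2 * ⟪(x : EuclideanSpace ℝ (Fin n)), v⟫ + α) := fun ε x => by
        rw [WSphere.power_eq, WSphere.power_eq, real_inner_comm v]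
        simp only [T, inner_add_left, inner_smul_left, RCLike.conj_to_real]
        ring
      have hrad : ∀ ε, (T ε).sqRadius = S.sqRadius
          + ε * (ε * ‖v‖ ^ 2 - (-2 * ⟪S.center, v⟫ + α)) := fun ε => by
        simp only [T, norm_add_sq_real, norm_smul, inner_smul_right, mul_pow, Real.norm_eq_abs,
          sq_abs]
        ring
      have hlt : ∀ f : ℝ → ℝ, Continuous f → f 0 < 0 →
          ∀ᶠ ε in nhdsWithin (0 : ℝ) (Set.Ioi 0), f ε < 0 := fun f hf h0 =>
        (hf.tendsto 0).eventually_lt_const h0 |>.filter_mono nhdsWithin_le_nhds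
      have e0 : ∀ᶠ ε in nhdsWithin (0 : ℝ) (Set.Ioi 0), 0 < ε := self_mem_nhdsWithin
      have e1 := hlt (fun ε => ε * ‖v‖ ^ 2 - (-2 * ⟪S.center, v⟫ + α)) (by fun_prop) (by
        simpa using hcon)
      have e2 : ∀ᶠ ε in nhdsWithin (0 : ℝ) (Set.Ioi 0), ∀ x ∈ Q, (T ε).Includes w x := by
        rw [Filter.eventually_all_finset]
        intro x hx
        simp only [WSphere.includes_iff, hpow]
        rcases (WSphere.includes_iff.1 (h.1.1 x hx)).lt_or_eq with h0 | h0
        · exact (hlt (fun ε => S.power w x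
            + ε * (-2 * ⟪(x : EuclideanSpace ℝ (Fin n)), v⟫ + α)) (by fun_prop)
            (by simpa using h0)).mono fun _ => le_of_lt
        · filter_upwards [e0] with ε hε
          rw [h0, zero_add]
          exact mul_nonpos_of_nonneg_of_nonpos hε.le (hQ x ⟨mem_onSet.2 h0, hx⟩)
      have e3 : ∀ᶠ ε in nhdsWithin (0 : ℝ) (Set.Ioi 0), ∀ x ∈ E, (T ε).Excludes w x := by
        rw [Filter.eventually_all_finite (Set.toFinite E)]
        intro x hx
        simp only [WSphere.excludes_iff, hpow]
        rcases (WSphere.excludes_iff.1 (h.1.2 x hx)).lt_or_eq with h0 | h0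
        · refine (hlt (fun ε => -(S.power w x
            + ε * (-2 * ⟪(x : EuclideanSpace ℝ (Fin n)), v⟫ + α))) (by fun_prop)
            (by simpa using h0)).mono fun ε hε => by linarith
        · filter_upwards [e0] with ε hε
          rw [← h0, zero_add]
          exact mul_nonneg hε.le (hE x ⟨mem_onSet.2 h0.symm, hx⟩)
      obtain ⟨ε, h0, h1, h2, h3⟩ := (e0.and (e1.and (e2.and e3))).exists
      have := h.2 (T ε) ⟨h2, h3⟩
      rw [hrad] at this
      nlinarith)
  simp only [Finset.mem_filter, Finset.mem_univ, true_and] at hA hB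
  refine ⟨ρ, ⟨fun x hx => ?_, ?_, ?_⟩, fun x hx => (hA x hx).2, fun x hx => (hB x hx).2⟩
  · rcases lt_trichotomy (ρ x) 0 with h0 | h0 | h0
    · exact absurd (hB x h0).1 hx
    · exact h0
    · exact absurd (hA x h0).1 hx
  -- The direction (0, 1) yields total weight one; the directions (v, 0) yield the center.
  · simpa [a, b, LinearMap.sum_apply] using (LinearMap.congr_fun hb (0, 1)).symm
  · refine ext_inner_right ℝ fun v => ?_
    have := LinearMap.congr_fun hb (v, 0)
    simp only [a, b, LinearMap.sum_apply, LinearMap.coprod_apply, LinearMap.smul_apply,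
      innerₛₗ_apply_apply, smul_eq_mul, LinearMap.id_apply, add_zero] at this
    simp only [sum_inner, inner_smul_left, RCLike.conj_to_real]
    have h2 : ∑ x, ρ x * (-2 * ⟪(x : EuclideanSpace ℝ (Fin n)), v⟫) =
        -2 * ∑ x, ρ x * ⟪(x : EuclideanSpace ℝ (Fin n)), v⟫ := by
      rw [Finset.mul_sum]; exact Finset.sum_congr rfl fun x _ => by ring
    rw [h2] at this
    linarith

theorem IsLeastSphere.nonempty {Q : Finset X} {E : Set X} {S : WSphere n}
    (h : IsLeastSphere w Q E S) : Q.Nonempty :=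
  h.exists_isMultiplier.choose_spec.nonempty

theorem IsLeastSphere.unique {Q : Finset X} {E : Set X} {S T : WSphere n}
    (h : IsLeastSphere w Q E S) (hT : Separates w Q E T) (hle : T.sqRadius ≤ S.sqRadius) :
    S = T := by
  obtain ⟨ρ, hρ⟩ := h.exists_isMultiplier
  have h1 := hρ.sq_dist_add_le hT
  have h2 := h.2 T hT
  have h3 : dist T.center S.center = 0 := by nlinarith [sq_nonneg (dist T.center S.center)]
  rcases S with ⟨z, s⟩
  rcases T with ⟨z', s'⟩
  have h4 : z' = z := dist_eq_zero.1 h3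
  have h5 : s = s' := le_antisymm h2 hle
  rw [h4, h5]

/-- A single point `q` of `Q` makes the problem compact: including `q` bounds the squared radius
below by `-w q` and keeps the center within a bounded distance of `q`. -/
theorem exists_isLeastSphere {Q : Finset X} (hQ : Q.Nonempty) {E : Set X} {T : WSphere n}
    (hT : Separates w Q E T) : ∃ S, IsLeastSphere w Q E S := by
  obtain ⟨q, hq⟩ := hQ
  let A : Set (EuclideanSpace ℝ (Fin n) × ℝ) :=
    {p | Separates w Q E ⟨p.1, p.2⟩ ∧ p.2 ≤ T.sqRadius}
  have hclosed : IsClosed A := by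
    have h1 : A = (⋂ x ∈ Q, {p | dist p.1 (x : EuclideanSpace ℝ (Fin n)) ^ 2 ≤ p.2 + w x}) ∩
        (⋂ x ∈ E, {p | p.2 + w x ≤ dist p.1 (x : EuclideanSpace ℝ (Fin n)) ^ 2}) ∩
        {p | p.2 ≤ T.sqRadius} := by
      ext p
      simp [A, Separates, WSphere.Includes, WSphere.Excludes]
    rw [h1]
    refine ((isClosed_biInter fun x _ => ?_).inter (isClosed_biInter fun x _ => ?_)).inter ?_
    · exact isClosed_le (by fun_prop) (by fun_prop)
    · exact isClosed_le (by fun_prop) (by fun_prop)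
    · exact isClosed_le (by fun_prop) (by fun_prop)
  have hcompact : IsCompact A := by
    refine ((isCompact_closedBall (q : EuclideanSpace ℝ (Fin n))
      (Real.sqrt (T.sqRadius + w q))).prod (isCompact_Icc (a := -w q) (b := T.sqRadius))).of_isClosed_subset
      hclosed ?_
    rintro ⟨z, s⟩ ⟨hp, hs⟩
    have h1 : dist z (q : EuclideanSpace ℝ (Fin n)) ^ 2 ≤ s + w q := hp.1 q hq
    have hs' : s ≤ T.sqRadius := hs
    refine ⟨?_, ?_, hs⟩
    · exact Real.le_sqrt_of_sq_le (by linarith)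
    · show -w q ≤ s
      nlinarith [sq_nonneg (dist z (q : EuclideanSpace ℝ (Fin n)))]
  obtain ⟨⟨z, s⟩, ⟨hsep, hs⟩, hmin⟩ := hcompact.exists_isMinOn ⟨(T.center, T.sqRadius), hT, le_rfl⟩
    continuous_snd.continuousOn
  refine ⟨⟨z, s⟩, hsep, fun T' hT' => ?_⟩
  rcases le_total T'.sqRadius T.sqRadius with h | h
  · exact hmin (show (T'.center, T'.sqRadius) ∈ A from ⟨hT', h⟩)
  · exact le_trans hs h

theorem Separates.mono {Q Q' : Finset X} {E E' : Set X} {S : WSphere n} (h : Separates w Q E S)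
    (hQ : Q' ⊆ Q) (hE : E' ⊆ E) : Separates w Q' E' S :=
  ⟨fun q hq => h.1 q (hQ hq), fun x hx => h.2 x (hE hx)⟩

/-- Adding included points to `Q` does not change the smallest separating sphere. -/
theorem IsLeastSphere.insert [DecidableEq X] {Q : Finset X} {E : Set X} {S : WSphere n}
    (h : IsLeastSphere w Q E S) {x : X} (hx : S.Includes w x) :
    IsLeastSphere w (insert x Q) E S :=
  ⟨⟨fun q hq => (Finset.mem_insert.1 hq).elim (fun h' => h' ▸ hx) (h.1.1 q), h.1.2⟩,
    fun T hT => h.2 T (hT.mono (Finset.subset_insert _ _) subset_rfl)⟩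

/-- Only points with positive coefficient have to belong to `Q`. -/
theorem IsMultiplier.erase [DecidableEq X] {Q : Finset X} {E : Set X} {S : WSphere n} {ρ : X → ℝ}
    (h : IsMultiplier w Q E S ρ) {x : X} (hx : ρ x ≤ 0) : IsMultiplier w (Q.erase x) E S ρ :=
  ⟨h.1, fun y hy => Finset.mem_erase.2 ⟨fun h' => absurd (h' ▸ hy) (not_lt.2 hx), h.2.1 y hy⟩, h.2.2⟩

/-- Removing points not on the sphere from `Q` does not change the smallest separating sphere. -/
theorem IsLeastSphere.erase [DecidableEq X] {Q : Finset X} {E : Set X} {S : WSphere n}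
    (h : IsLeastSphere w Q E S) {x : X} (hx : x ∉ onSet w S) :
    IsLeastSphere w (Q.erase x) E S := by
  obtain ⟨ρ, hρ⟩ := h.exists_isMultiplier
  exact (hρ.erase (hρ.1.1 x hx).le).isLeastSphere (h.1.mono (Finset.erase_subset _ _) subset_rfl)

open Classical in
/-- The smallest sphere that includes `Q` and excludes `E`, if there is one. -/
noncomputable def leastSphere (w : X → ℝ) (E : Set X) (Q : Finset X) : WSphere n :=
  if h : ∃ S, IsLeastSphere w Q E S then h.choose else ⟨0, 0⟩

theorem IsLeastSphere.leastSphere_eq {Q : Finset X} {E : Set X} {S : WSphere n}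
    (h : IsLeastSphere w Q E S) : leastSphere w E Q = S := by
  have h' : ∃ S, IsLeastSphere w Q E S := ⟨S, h⟩
  rw [leastSphere, dif_pos h']
  exact h'.choose_spec.unique h.1 (h.2 _ h'.choose_spec.1)

/-- Smallest separating spheres of equal size of nested sets agree. -/
theorem leastSphere_eq_of_subset {Q Q' : Finset X} {E : Set X} {S S' : WSphere n}
    (h : IsLeastSphere w Q E S) (h' : IsLeastSphere w Q' E S') (hQ : Q ⊆ Q')
    (hr : S'.sqRadius ≤ S.sqRadius) : S = S' :=
  h.unique (h'.1.mono hQ subset_rfl) hr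

end LeastSpheres

/-! ### Consequences of general position -/

section GeneralPosition

variable {n : ℕ} {X : Finset (EuclideanSpace ℝ (Fin n))} {w : X → ℝ}

/-- Any `n + 1` points on `S` are affinely independent, so their affine hull contains the center. By
`sum_mul_power`, `S` is then their smallest circumsphere, on which no further point may lie. -/
theorem InGeneralPosition.card_onSet_le (hgen : InGeneralPosition w) (S : WSphere n) :
    (onSet w S).card ≤ n + 1 := by
  by_contra hcon
  push Not at hcon
  obtain ⟨P, hPS, hP⟩ := Finset.exists_subset_card_eq hcon.le
  obtain ⟨hind, hcirc⟩ := hgen P hP.le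
  have htop : affineSpan ℝ (Set.range fun q : P => ((q : X) : EuclideanSpace ℝ (Fin n))) = ⊤ :=
    hind.affineSpan_eq_top_iff_card_eq_finrank_add_one.2 (by simp [hP])
  obtain ⟨ρ, hρ, hc⟩ := eq_affineCombination_of_mem_affineSpan_of_fintype
    (htop ▸ AffineSubspace.mem_top ℝ _ S.center)
  rw [Finset.affineCombination_eq_linear_combination _ _ _ hρ] at hc
  obtain ⟨x, hxS, hxP⟩ : ∃ x ∈ onSet w S, x ∉ P := by
    by_contra h
    push Not at h
    have := Finset.card_le_card (show onSet w S ⊆ P from h)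
    omega
  refine hcirc S ⟨fun q hq => WSphere.liesOn_iff.2 (mem_onSet.1 (hPS hq)), fun T hT => ?_⟩ x hxP
    (WSphere.liesOn_iff.2 (mem_onSet.1 hxS))
  classical
  have hsum : ∀ {M : Type} [AddCommMonoid M] (f : ℝ → X → M), (∀ x, f 0 x = 0) →
      ∑ x, f (if h : x ∈ P then ρ ⟨x, h⟩ else 0) x = ∑ x : P, f (ρ x) x := by
    intro M _ f hf
    rw [← Finset.sum_subset (Finset.subset_univ P) (fun x _ hx => by rw [dif_neg hx, hf]),
      ← Finset.sum_coe_sort]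
    exact Finset.sum_congr rfl fun x _ => by rw [dif_pos x.2]
  have hm : IsMultiplier w P Set.univ S (fun x => if h : x ∈ P then ρ ⟨x, h⟩ else 0) := by
    refine ⟨⟨fun x hx => dif_neg fun h => hx (hPS h), ?_, ?_⟩, fun x hx => ?_, fun _ _ => trivial⟩
    · rw [hsum (fun r _ => r) (fun _ => rfl), hρ]
    · rw [hsum (fun r x => r • (x : EuclideanSpace ℝ (Fin n))) (fun _ => zero_smul _ _), hc]
    · by_contra h
      beta_reduce at hx
      rw [dif_neg h] at hx
      exact lt_irrefl _ hx
  have h1 := sum_mul_power (w := w) hm.1.2.1 hm.1.2.2 T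
  rw [hm.1.sum_mul_power_eq_zero, Finset.sum_eq_zero fun x _ => ?_] at h1
  · nlinarith [sq_nonneg (dist T.center S.center)]
  · by_cases h : x ∈ P
    · rw [WSphere.liesOn_iff.1 (hT x h), mul_zero]
    · rw [dif_neg h, zero_mul]

/-- By the cardinality bound the points on `S` are affinely independent, so barycentric coordinates
are unique. Hence any multiplier computes the front face. -/
theorem InGeneralPosition.isCenterCombination_unique (hgen : InGeneralPosition w) {S : WSphere n}
    {ρ ρ' : X → ℝ} (h : IsCenterCombination w S ρ) (h' : IsCenterCombination w S ρ') : ρ = ρ' := by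
  have hind := (hgen _ (hgen.card_onSet_le S)).1
  have hsum : ∀ {M : Type} [AddCommGroup M] (f : X → M), (∀ x ∉ onSet w S, f x = 0) →
      ∑ x : onSet w S, f x = ∑ x, f x := fun f hf => by
    rw [Finset.sum_coe_sort (onSet w S) f]
    exact Finset.sum_subset (Finset.subset_univ _) fun x _ hx => hf x hx
  have h0 : ∀ x ∉ onSet w S, ρ x - ρ' x = 0 := fun x hx => by rw [h.1 x hx, h'.1 x hx, sub_self]
  have key := (affineIndependent_iff.1 hind) Finset.univ (fun x => ρ x - ρ' x)
    (by rw [hsum (fun x => ρ x - ρ' x) h0, Finset.sum_sub_distrib, h.2.1, h'.2.1, sub_self])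
    (by
      rw [hsum (fun x => (ρ x - ρ' x) • (x : EuclideanSpace ℝ (Fin n)))
        (fun x hx => by rw [h0 x hx, zero_smul])]
      simp only [sub_smul, Finset.sum_sub_distrib]
      rw [h.2.2, h'.2.2, sub_self])
  ext x
  by_cases hx : x ∈ onSet w S
  · exact sub_eq_zero.1 (key ⟨x, hx⟩ (Finset.mem_univ _))
  · rw [h.1 x hx, h'.1 x hx]

theorem InGeneralPosition.mem_front_iff (hgen : InGeneralPosition w) {S : WSphere n} {ρ : X → ℝ}
    (h : IsCenterCombination w S ρ) {x : X} : x ∈ front w S ↔ 0 < ρ x := by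
  simp only [front, Finset.mem_filter]
  constructor
  · rintro ⟨-, ρ', h', hx⟩
    rwa [hgen.isCenterCombination_unique h h']
  · refine fun hx => ⟨?_, ρ, h, hx⟩
    by_contra hx'
    exact hx.ne' (h.1 x hx')

theorem front_subset_onSet (S : WSphere n) : front w S ⊆ onSet w S := by
  classical exact Finset.filter_subset _ _

end GeneralPosition

end WeightedDelaunay

namespace WeightedDelaunay

/-! ### Membership in the complexes through smallest separating spheres -/

section Faces

variable {n : ℕ} {X : Finset (EuclideanSpace ℝ (Fin n))} {w : X → ℝ} {s : ℝ}

theorem mem_cech_iff {Q : Finset X} :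
    Q ∈ (cech w s).faces ↔ ∃ S, IsLeastSphere w Q ∅ S ∧ S.sqRadius ≤ s := by
  constructor
  · rintro ⟨hQ, y, hy⟩
    simp only [Set.mem_iInter] at hy
    have hT : Separates w Q ∅ ⟨y, s⟩ := ⟨hy, fun x hx => hx.elim⟩
    obtain ⟨S, hS⟩ := exists_isLeastSphere hQ hT
    exact ⟨S, hS, hS.2 _ hT⟩
  · rintro ⟨S, hS, hs⟩
    refine ⟨hS.nonempty, S.center, ?_⟩
    simp only [Set.mem_iInter]
    exact fun x hx => (hS.1.1 x hx).trans (add_le_add_left hs _)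

theorem Separates.center_mem_voronoi {Q : Finset X} {S : WSphere n}
    (h : Separates w Q Set.univ S) {x : X} (hx : x ∈ Q) : S.center ∈ voronoi w x := fun p => by
  have h1 : dist S.center (x : EuclideanSpace ℝ (Fin n)) ^ 2 ≤ S.sqRadius + w x := h.1 x hx
  have h2 : S.sqRadius + w p ≤ dist S.center (p : EuclideanSpace ℝ (Fin n)) ^ 2 := h.2 p trivial
  linarith

theorem separates_of_mem_voronoi {Q : Finset X} {y : EuclideanSpace ℝ (Fin n)}
    (hy : ∀ x ∈ Q, y ∈ voronoi w x) {q : X} (hq : q ∈ Q) :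
    Separates w Q Set.univ ⟨y, dist y (q : EuclideanSpace ℝ (Fin n)) ^ 2 - w q⟩ :=
  ⟨fun x hx => by have := hy x hx q; rw [WSphere.Includes]; linarith,
    fun x _ => by have := hy q hq x; rw [WSphere.Excludes]; linarith⟩

theorem mem_delaunayTriangulation_iff {Q : Finset X} :
    Q ∈ (delaunayTriangulation w).faces ↔ ∃ S, IsLeastSphere w Q Set.univ S := by
  constructor
  · rintro ⟨hQ, y, hy⟩
    simp only [Set.mem_iInter] at hy
    obtain ⟨q, hq⟩ := hQ
    exact exists_isLeastSphere ⟨q, hq⟩ (separates_of_mem_voronoi hy hq)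
  · rintro ⟨S, hS⟩
    refine ⟨hS.nonempty, S.center, ?_⟩
    simp only [Set.mem_iInter]
    exact fun x hx => hS.1.center_mem_voronoi hx

theorem mem_delaunay_iff {Q : Finset X} :
    Q ∈ (delaunay w s).faces ↔ ∃ S, IsLeastSphere w Q Set.univ S ∧ S.sqRadius ≤ s := by
  constructor
  · rintro ⟨hQ, y, hy⟩
    simp only [Set.mem_iInter] at hy
    obtain ⟨q, hq⟩ := hQ
    have hT := separates_of_mem_voronoi (fun x hx => (hy x hx).2) hq
    obtain ⟨S, hS⟩ := exists_isLeastSphere ⟨q, hq⟩ hT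
    refine ⟨S, hS, (hS.2 _ hT).trans ?_⟩
    have : dist y (q : EuclideanSpace ℝ (Fin n)) ^ 2 ≤ s + w q := (hy q hq).1
    dsimp only
    linarith
  · rintro ⟨S, hS, hs⟩
    refine ⟨hS.nonempty, S.center, ?_⟩
    simp only [Set.mem_iInter]
    exact fun x hx => ⟨(hS.1.1 x hx).trans (add_le_add_left hs _), hS.1.center_mem_voronoi hx⟩

theorem mem_delaunayCech_iff {Q : Finset X} :
    Q ∈ (delaunayCech w s).faces ↔
      (∃ T, IsLeastSphere w Q Set.univ T) ∧ ∃ S, IsLeastSphere w Q ∅ S ∧ S.sqRadius ≤ s := by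
  rw [← mem_delaunayTriangulation_iff, ← mem_cech_iff]
  exact Iff.rfl

theorem delaunayCech_le_cech : delaunayCech w ≤ cech w := fun _ _ hQ => hQ.2

theorem delaunay_le_delaunayCech : delaunay w ≤ delaunayCech w := by
  refine fun s Q hQ => ?_
  obtain ⟨T, hT, hs⟩ := mem_delaunay_iff.1 hQ
  have hT' := hT.1.mono subset_rfl (Set.empty_subset _)
  obtain ⟨S, hS⟩ := exists_isLeastSphere hT.nonempty hT'
  exact mem_delaunayCech_iff.2 ⟨⟨T, hT⟩, S, hS, (hS.2 _ hT').trans hs⟩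

end Faces

/-! ### Collapsing the Čech complex to the Delaunay–Čech complex -/

section Certificates

open scoped RealInnerProductSpace

variable {n : ℕ} {X : Finset (EuclideanSpace ℝ (Fin n))} {w : X → ℝ}

/-- The Farkas certificates against spheres that include `Q` and exclude `X`. -/
def certificates (w : X → ℝ) (Q : Finset X) : Set (EuclideanSpace ℝ X) :=
  {l | ∑ x, l x = 0 ∧ ∑ x, l x • (x : EuclideanSpace ℝ (Fin n)) = 0 ∧
    ∑ x, l x * (‖(x : EuclideanSpace ℝ (Fin n))‖ ^ 2 - w x) = 1 ∧ ∀ x, x ∉ Q → l x ≤ 0}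

theorem certificates_mono {Q Q' : Finset X} (h : Q ⊆ Q') :
    certificates w Q ⊆ certificates w Q' :=
  fun _ hl => ⟨hl.1, hl.2.1, hl.2.2.1, fun x hx => hl.2.2.2 x fun hx' => hx (h hx')⟩

/-- The sign condition is asked only of the combination, so that `l'` may violate it, as happens in
`IsLeastCertificate.insert`. -/
theorem certificates_combo {Q : Finset X} {l l' : EuclideanSpace ℝ X}
    (h1 : ∑ x, l x = 0 ∧ ∑ x, l x • (x : EuclideanSpace ℝ (Fin n)) = 0 ∧
      ∑ x, l x * (‖(x : EuclideanSpace ℝ (Fin n))‖ ^ 2 - w x) = 1)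
    (h2 : ∑ x, l' x = 0 ∧ ∑ x, l' x • (x : EuclideanSpace ℝ (Fin n)) = 0 ∧
      ∑ x, l' x * (‖(x : EuclideanSpace ℝ (Fin n))‖ ^ 2 - w x) = 1) (t : ℝ)
    (h : ∀ x, x ∉ Q → (1 - t) * l x + t * l' x ≤ 0) :
    (1 - t) • l + t • l' ∈ certificates w Q := by
  refine ⟨?_, ?_, ?_, h⟩
  · simp [-Finset.univ_eq_attach, Finset.sum_add_distrib, ← Finset.mul_sum, h1.1, h2.1]
  · simp [-Finset.univ_eq_attach, Finset.sum_add_distrib, add_smul, mul_smul, ← Finset.smul_sum, h1.2.1, h2.2.1]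
  · simp [-Finset.univ_eq_attach, Finset.sum_add_distrib, add_mul, mul_assoc, ← Finset.mul_sum, h1.2.2, h2.2.2]

theorem convex_certificates (Q : Finset X) : Convex ℝ (certificates w Q) := by
  intro l hl l' hl' a b ha hb hab
  obtain rfl : a = 1 - b := by linarith
  exact certificates_combo ⟨hl.1, hl.2.1, hl.2.2.1⟩ ⟨hl'.1, hl'.2.1, hl'.2.2.1⟩ b fun x hx =>
    add_nonpos (mul_nonpos_of_nonneg_of_nonpos ha (hl.2.2.2 x hx))
      (mul_nonpos_of_nonneg_of_nonpos hb (hl'.2.2.2 x hx))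

theorem isClosed_certificates (Q : Finset X) : IsClosed (certificates w Q) := by
  have h : certificates w Q = {l | ∑ x, l x = 0} ∩
      {l | ∑ x : X, l x • (x : EuclideanSpace ℝ (Fin n)) = 0} ∩
      {l | ∑ x : X, l x * (‖(x : EuclideanSpace ℝ (Fin n))‖ ^ 2 - w x) = 1} ∩
      ⋂ x, ⋂ (_ : x ∉ Q), {l | l x ≤ 0} := by
    ext l
    simp [certificates, and_assoc]
  rw [h]
  refine (((isClosed_eq (by fun_prop) (by fun_prop)).inter
    (isClosed_eq (by fun_prop) (by fun_prop))).inter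
    (isClosed_eq (by fun_prop) (by fun_prop))).inter
    (isClosed_iInter fun x => isClosed_iInter fun _ => isClosed_le (by fun_prop) (by fun_prop))

theorem sum_certificate_mul_power {Q : Finset X} {l : EuclideanSpace ℝ X}
    (hl : l ∈ certificates w Q) (S : WSphere n) : ∑ x, l x * S.power w x = 1 := by
  have h1 : ∑ x, l x * ⟪S.center, (x : EuclideanSpace ℝ (Fin n))⟫ = 0 := by
    simpa [inner_sum, inner_smul_right] using congrArg (fun v => ⟪S.center, v⟫) hl.2.1
  have : ∀ x, l x * S.power w x = l x * (‖(x : EuclideanSpace ℝ (Fin n))‖ ^ 2 - w x)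
      - 2 * (l x * ⟪S.center, (x : EuclideanSpace ℝ (Fin n))⟫)
      + l x * (‖S.center‖ ^ 2 - S.sqRadius) := fun x => by rw [S.power_eq]; ring
  rw [Finset.sum_congr rfl fun x _ => this x, Finset.sum_add_distrib, Finset.sum_sub_distrib,
    ← Finset.mul_sum, ← Finset.sum_mul, hl.2.2.1, h1, hl.1]
  ring

/-- The products of coefficients and powers sum to one. Positive coefficients occur only on `Q`,
where powers are nonpositive, so a positive product needs two negative factors. The point found is
the one toggled in the matching. -/
theorem exists_neg_of_mem_certificates {Q : Finset X} {l : EuclideanSpace ℝ X}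
    (hl : l ∈ certificates w Q) {S : WSphere n} (hS : ∀ q ∈ Q, S.Includes w q) :
    ∃ x, l x < 0 ∧ S.power w x < 0 := by
  by_contra! hcon
  have h : ∑ x, l x * S.power w x ≤ 0 := Finset.sum_nonpos fun x _ => by
    rcases lt_or_ge (l x) 0 with h | h
    · exact mul_nonpos_of_nonpos_of_nonneg h.le (hcon x h)
    · by_cases hx : x ∈ Q
      · exact mul_nonpos_of_nonneg_of_nonpos h (WSphere.includes_iff.1 (hS x hx))
      · rw [le_antisymm (hl.2.2.2 x hx) h, zero_mul]
  linarith [sum_certificate_mul_power hl S]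

theorem not_separates_of_mem_certificates {Q : Finset X} {l : EuclideanSpace ℝ X}
    (hl : l ∈ certificates w Q) (S : WSphere n) : ¬ Separates w Q Set.univ S := fun hS => by
  obtain ⟨x, -, hx⟩ := exists_neg_of_mem_certificates hl hS.1
  exact absurd (WSphere.excludes_iff.1 (hS.2 x trivial)) (not_le.2 hx)

theorem certificates_nonempty {Q : Finset X} (h : ∀ S, ¬ Separates w Q Set.univ S) :
    (certificates w Q).Nonempty := by
  classical
  -- The power is homogenized by a third coordinate `t`, and `b` reads off `t`. A solution with `t`
  -- positive would, divided by `t`, be a separating sphere.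
  let a : X → (EuclideanSpace ℝ (Fin n) × ℝ × ℝ) →ₗ[ℝ] ℝ := fun x =>
    LinearMap.coprod ((-2 : ℝ) • (innerₛₗ ℝ (x : EuclideanSpace ℝ (Fin n))))
      (LinearMap.coprod LinearMap.id
        ((‖(x : EuclideanSpace ℝ (Fin n))‖ ^ 2 - w x) • LinearMap.id))
  let b : (EuclideanSpace ℝ (Fin n) × ℝ × ℝ) →ₗ[ℝ] ℝ :=
    LinearMap.coprod 0 (LinearMap.coprod 0 LinearMap.id)
  obtain ⟨ρ, hA, -, hb⟩ := exists_signed_combination Q Finset.univ a b (by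
    rintro ⟨v, α, t⟩ hQ hX
    by_contra hcon
    simp only [a, b, LinearMap.coprod_apply, LinearMap.smul_apply, LinearMap.zero_apply,
      innerₛₗ_apply_apply, smul_eq_mul, LinearMap.id_apply, not_le, zero_add, Finset.mem_univ,
      true_imp_iff] at hQ hX hcon
    have hpow : ∀ x : X, (⟨t⁻¹ • v, ‖t⁻¹ • v‖ ^ 2 - t⁻¹ * α⟩ : WSphere n).power w x =
        t⁻¹ * (-2 * ⟪(x : EuclideanSpace ℝ (Fin n)), v⟫
          + (α + (‖(x : EuclideanSpace ℝ (Fin n))‖ ^ 2 - w x) * t)) := fun x => by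
      rw [WSphere.power_eq, inner_smul_left, real_inner_comm v, RCLike.conj_to_real]
      field_simp
      ring
    refine h ⟨t⁻¹ • v, ‖t⁻¹ • v‖ ^ 2 - t⁻¹ * α⟩ ⟨fun x hx => ?_, fun x _ => ?_⟩
    · rw [WSphere.includes_iff, hpow]
      exact mul_nonpos_of_nonneg_of_nonpos (by positivity) (hQ x hx)
    · rw [WSphere.excludes_iff, hpow]
      exact mul_nonneg (by positivity) (hX x))
  refine ⟨WithLp.toLp 2 ρ, ?_, ?_, ?_, fun x hx => ?_⟩
  · simpa [a, b, LinearMap.sum_apply] using (LinearMap.congr_fun hb (0, 1, 0)).symm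
  · refine ext_inner_right ℝ fun v => ?_
    have := LinearMap.congr_fun hb (v, 0, 0)
    simp only [a, b, LinearMap.sum_apply, LinearMap.coprod_apply, LinearMap.smul_apply,
      innerₛₗ_apply_apply, smul_eq_mul, LinearMap.id_apply, add_zero, mul_zero,
      LinearMap.zero_apply] at this
    simp only [sum_inner, inner_smul_left, RCLike.conj_to_real, inner_zero_left]
    have h2 : ∑ x, ρ x * (-2 * ⟪(x : EuclideanSpace ℝ (Fin n)), v⟫) =
        -2 * ∑ x, ρ x * ⟪(x : EuclideanSpace ℝ (Fin n)), v⟫ := by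
      rw [Finset.mul_sum]; exact Finset.sum_congr rfl fun x _ => by ring
    rw [h2] at this
    linarith
  · simpa [a, b, LinearMap.sum_apply] using (LinearMap.congr_fun hb (0, 0, 1)).symm
  · by_contra hcon
    exact hx (hA x (not_le.1 hcon))

/-- `l` is the shortest Farkas certificate for `Q`. -/
def IsLeastCertificate (w : X → ℝ) (Q : Finset X) (l : EuclideanSpace ℝ X) : Prop :=
  l ∈ certificates w Q ∧ ∀ l' ∈ certificates w Q, ‖l‖ ≤ ‖l'‖

theorem exists_isLeastCertificate {Q : Finset X} (h : (certificates w Q).Nonempty) :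
    ∃ l, IsLeastCertificate w Q l := by
  obtain ⟨l, hl, hd⟩ := (isClosed_certificates (w := w) Q).exists_infDist_eq_dist h 0
  refine ⟨l, hl, fun l' hl' => ?_⟩
  have := Metric.infDist_le_dist_of_mem (x := 0) hl'
  rwa [hd, dist_zero_left, dist_zero_left] at this

theorem IsLeastCertificate.unique {Q : Finset X} {l l' : EuclideanSpace ℝ X}
    (h : IsLeastCertificate w Q l) (hl' : l' ∈ certificates w Q) (hle : ‖l'‖ ≤ ‖l‖) : l = l' := by
  have h1 := h.2 _ ((convex_certificates Q) h.1 hl' (by norm_num : (0 : ℝ) ≤ 1 / 2)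
    (by norm_num : (0 : ℝ) ≤ 1 / 2) (by norm_num))
  rw [← smul_add, norm_smul, Real.norm_of_nonneg (by norm_num)] at h1
  have h2 := parallelogram_law_with_norm ℝ l l'
  have h3 : ‖l - l'‖ = 0 := by
    nlinarith [norm_nonneg l, norm_nonneg l', norm_nonneg (l - l'), norm_nonneg (l + l')]
  exact sub_eq_zero.1 (norm_eq_zero.1 h3)

/-- Dropping an inactive constraint does not change the shortest certificate. -/
theorem IsLeastCertificate.insert [DecidableEq X] {Q : Finset X} {l : EuclideanSpace ℝ X}
    (h : IsLeastCertificate w Q l) {x : X} (hx : l x < 0) :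
    IsLeastCertificate w (insert x Q) l := by
  refine ⟨certificates_mono (Finset.subset_insert _ _) h.1, fun l' hl' => ?_⟩
  by_contra! hcon
  -- For small positive `t`, moving from `l` towards a shorter certificate `l'` of the larger set
  -- keeps the coefficient of `x` negative. This gives a certificate for `Q` shorter than `l`.
  have e0 : ∀ᶠ t in nhdsWithin (0 : ℝ) (Set.Ioi 0), 0 < t := self_mem_nhdsWithin
  have hc : ∀ f : ℝ → ℝ, Continuous f → f 0 < 0 →
      ∀ᶠ t in nhdsWithin (0 : ℝ) (Set.Ioi 0), f t < 0 := fun f hf h0 =>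
    (hf.tendsto 0).eventually_lt_const h0 |>.filter_mono nhdsWithin_le_nhds
  have e1 := hc (fun t => t - 1) (by fun_prop) (by norm_num)
  have e2 := hc (fun t => (1 - t) * l x + t * l' x) (by fun_prop) (by simpa using hx)
  obtain ⟨t, h0, h1, h2⟩ := (e0.and (e1.and e2)).exists
  have hmem : (1 - t) • l + t • l' ∈ certificates w Q := by
    refine certificates_combo ⟨h.1.1, h.1.2.1, h.1.2.2.1⟩ ⟨hl'.1, hl'.2.1, hl'.2.2.1⟩ t
      fun y hy => ?_
    by_cases hyx : y = x
    · rw [hyx]; exact h2.le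
    · exact add_nonpos (mul_nonpos_of_nonneg_of_nonpos (by linarith) (h.1.2.2.2 y hy))
        (mul_nonpos_of_nonneg_of_nonpos h0.le (hl'.2.2.2 y fun hy' =>
          (Finset.mem_insert.1 hy').elim hyx hy))
  have h3 := h.2 _ hmem
  have h4 := norm_add_le ((1 - t) • l) (t • l')
  rw [norm_smul, norm_smul, Real.norm_of_nonneg (by linarith), Real.norm_of_nonneg h0.le] at h4
  nlinarith

theorem IsLeastCertificate.erase [DecidableEq X] {Q : Finset X} {l : EuclideanSpace ℝ X}
    (h : IsLeastCertificate w Q l) {x : X} (hx : l x < 0) :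
    IsLeastCertificate w (Q.erase x) l := by
  refine ⟨⟨h.1.1, h.1.2.1, h.1.2.2.1, fun y hy => ?_⟩,
    fun l' hl' => h.2 l' (certificates_mono (Finset.erase_subset _ _) hl')⟩
  by_cases hyx : y = x
  · rw [hyx]; exact hx.le
  · exact h.1.2.2.2 y fun hy' => hy (Finset.mem_erase.2 ⟨hyx, hy'⟩)

open Classical in
/-- The shortest Farkas certificate for `Q`, if there is one. -/
noncomputable def leastCertificate (w : X → ℝ) (Q : Finset X) : EuclideanSpace ℝ X :=
  if h : ∃ l, IsLeastCertificate w Q l then h.choose else 0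

theorem IsLeastCertificate.leastCertificate_eq {Q : Finset X} {l : EuclideanSpace ℝ X}
    (h : IsLeastCertificate w Q l) : leastCertificate w Q = l := by
  have h' : ∃ l, IsLeastCertificate w Q l := ⟨l, h⟩
  rw [leastCertificate, dif_pos h']
  exact h'.choose_spec.unique h.1 (h.2 _ h'.choose_spec.1)

/-- Toggling a point strictly inside the Čech sphere keeps that sphere, and toggling a point with
negative coefficient keeps the shortest certificate. As `Q` grows the radius increases while the
certificates become more numerous and the least norm drops, hence the minus sign in the monotone
function. -/
theorem collapses_cech_delaunayCech (w : X → ℝ) (s : ℝ) :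
    Collapses (cech w s) (delaunayCech w s) := by
  classical
  have hD : ∀ Q, Q ∈ (cech w s).faces \ (delaunayCech w s).faces ↔
      (∃ S, IsLeastSphere w Q ∅ S ∧ S.sqRadius ≤ s) ∧ ∃ l, IsLeastCertificate w Q l := by
    intro Q
    rw [Set.mem_sdiff, mem_cech_iff, mem_delaunayCech_iff]
    refine and_congr_right fun hS => ⟨fun h => ?_, ?_⟩
    · refine exists_isLeastCertificate (certificates_nonempty fun T hT => h ⟨?_, hS⟩)
      exact exists_isLeastSphere hS.choose_spec.1.nonempty hT
    · rintro ⟨l, hl⟩ ⟨⟨T, hT⟩, -⟩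
      exact not_separates_of_mem_certificates hl.1 T hT.1
  refine collapses_of_matching _
    (fun Q => (leastSphere w ∅ Q).sqRadius - ‖leastCertificate w Q‖)
    (fun Q x => leastCertificate w Q x < 0 ∧ (leastSphere w ∅ Q).power w x < 0) _
    (delaunayCech_le_cech s) (fun Q hQ => ?_) (fun Q hQ x hx => ?_) (fun Q hQ Q' hQ' hle => ?_)
    (fun Q hQ Q' hQ' hle heq => ?_)
  · obtain ⟨⟨S, hS, hs⟩, l, hl⟩ := (hD Q).1 hQ
    rw [hS.leastSphere_eq, hl.leastCertificate_eq]
    exact exists_neg_of_mem_certificates hl.1 hS.1.1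
  · obtain ⟨⟨S, hS, hs⟩, l, hl⟩ := (hD Q).1 hQ
    rw [hS.leastSphere_eq, hl.leastCertificate_eq] at hx
    have hSi := hS.insert (WSphere.includes_iff.2 hx.2.le)
    have hSe := hS.erase (fun h => hx.2.ne (mem_onSet.1 h))
    have hli := hl.insert hx.1
    have hle := hl.erase hx.1
    refine ⟨(hD _).2 ⟨⟨S, hSi, hs⟩, l, hli⟩, (hD _).2 ⟨⟨S, hSe, hs⟩, l, hle⟩, ?_⟩
    rw [hSi.leastSphere_eq, hSe.leastSphere_eq, hli.leastCertificate_eq, hle.leastCertificate_eq]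
  · obtain ⟨⟨S, hS, -⟩, l, hl⟩ := (hD Q).1 hQ
    obtain ⟨⟨S', hS', -⟩, l', hl'⟩ := (hD Q').1 hQ'
    rw [hS.leastSphere_eq, hl.leastCertificate_eq, hS'.leastSphere_eq, hl'.leastCertificate_eq]
    linarith [hS.2 _ (hS'.1.mono hle subset_rfl), hl'.2 _ (certificates_mono hle hl.1)]
  · obtain ⟨⟨S, hS, -⟩, l, hl⟩ := (hD Q).1 hQ
    obtain ⟨⟨S', hS', -⟩, l', hl'⟩ := (hD Q').1 hQ'
    rw [hS.leastSphere_eq, hl.leastCertificate_eq, hS'.leastSphere_eq,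
      hl'.leastCertificate_eq] at heq
    have h1 := hS.2 _ (hS'.1.mono hle subset_rfl)
    have h2 := hl'.2 _ (certificates_mono hle hl.1)
    have h3 : S = S' := leastSphere_eq_of_subset hS hS' hle (by linarith)
    have h4 : l' = l := hl'.unique (certificates_mono hle hl.1) (by linarith)
    rw [hS.leastSphere_eq, hl.leastCertificate_eq, hS'.leastSphere_eq, hl'.leastCertificate_eq,
      h3, h4]

end Certificates

/-! ### Collapsing the Delaunay–Čech complex to the Delaunay complex -/

section DelaunaySpheres

variable {n : ℕ} {X : Finset (EuclideanSpace ℝ (Fin n))} {w : X → ℝ}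

theorem InGeneralPosition.front_subset (hgen : InGeneralPosition w) {Q : Finset X} {E : Set X}
    {S : WSphere n} (h : IsLeastSphere w Q E S) : front w S ⊆ Q := by
  obtain ⟨ρ, hρ⟩ := h.exists_isMultiplier
  exact fun x hx => hρ.2.1 x ((hgen.mem_front_iff hρ.1).1 hx)

theorem Separates.subset_onSet {Q : Finset X} {S : WSphere n} (h : Separates w Q Set.univ S) :
    Q ⊆ onSet w S := fun x hx =>
  mem_onSet.2 (WSphere.liesOn_iff.1 ⟨h.1 x hx, h.2 x trivial⟩)

/-- With all of `X` excluded, negative coefficients are unrestricted, so the multiplier of `S`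
serves every `P` that contains the front face. -/
theorem InGeneralPosition.isLeastSphere_of_mem_Icc (hgen : InGeneralPosition w) {Q P : Finset X}
    {S : WSphere n} (h : IsLeastSphere w Q Set.univ S)
    (hP : P ∈ Set.Icc (front w S) (onSet w S)) : IsLeastSphere w P Set.univ S := by
  obtain ⟨ρ, hρ⟩ := h.exists_isMultiplier
  have hm : IsMultiplier w P Set.univ S ρ :=
    ⟨hρ.1, fun x hx => hP.1 ((hgen.mem_front_iff hρ.1).2 hx), fun _ _ => trivial⟩
  refine hm.isLeastSphere ⟨fun x hx => ?_, h.1.2⟩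
  exact WSphere.includes_iff.2 (mem_onSet.1 (hP.2 hx)).le

theorem InGeneralPosition.insert_erase_mem_Icc [DecidableEq X] (hgen : InGeneralPosition w)
    {Q : Finset X} {S : WSphere n} (h : IsLeastSphere w Q Set.univ S) {x : X}
    (hx : x ∈ onSet w S) (hx' : x ∉ front w S) :
    insert x Q ∈ Set.Icc (front w S) (onSet w S) ∧
      Q.erase x ∈ Set.Icc (front w S) (onSet w S) :=
  ⟨⟨(hgen.front_subset h).trans (Finset.subset_insert _ _),
      Finset.insert_subset hx h.1.subset_onSet⟩,
    ⟨fun _ hy => Finset.mem_erase.2 ⟨fun hyx => hx' (hyx ▸ hy), hgen.front_subset h hy⟩,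
      (Finset.erase_subset _ _).trans h.1.subset_onSet⟩⟩

theorem InGeneralPosition.collapses_delaunayCech_delaunay (hgen : InGeneralPosition w) (s : ℝ) :
    Collapses (delaunayCech w s) (delaunay w s) := by
  classical
  have hD : ∀ Q, Q ∈ (delaunayCech w s).faces \ (delaunay w s).faces ↔
      (∃ T, IsLeastSphere w Q Set.univ T ∧ s < T.sqRadius) ∧
        ∃ S, IsLeastSphere w Q ∅ S ∧ S.sqRadius ≤ s := by
    intro Q
    rw [Set.mem_sdiff, mem_delaunayCech_iff, mem_delaunay_iff]
    constructor
    · rintro ⟨⟨⟨T, hT⟩, hS⟩, h⟩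
      exact ⟨⟨T, hT, not_le.1 fun hs => h ⟨T, hT, hs⟩⟩, hS⟩
    · rintro ⟨⟨T, hT, hs⟩, hS⟩
      refine ⟨⟨⟨T, hT⟩, hS⟩, ?_⟩
      rintro ⟨T', hT', hs'⟩
      exact absurd (hT.2 _ hT'.1) (not_le.2 (hs'.trans_lt hs))
  refine collapses_of_matching _
    (fun Q => (leastSphere w ∅ Q).sqRadius + (leastSphere w Set.univ Q).sqRadius)
    (fun Q x => (x ∈ onSet w (leastSphere w Set.univ Q) ∧ x ∉ front w (leastSphere w Set.univ Q)) ∧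
      (leastSphere w ∅ Q).power w x < 0) _
    (delaunay_le_delaunayCech s) (fun Q hQ => ?_) (fun Q hQ x hx => ?_)
    (fun Q hQ Q' hQ' hle => ?_) (fun Q hQ Q' hQ' hle heq => ?_)
  · obtain ⟨⟨T, hT, hsT⟩, S, hS, hs⟩ := (hD Q).1 hQ
    rw [hS.leastSphere_eq, hT.leastSphere_eq]
    obtain ⟨ρ, hρ⟩ := hT.exists_isMultiplier
    have h1 := sum_mul_power (w := w) hρ.1.2.1 hρ.1.2.2 S
    rw [hρ.1.sum_mul_power_eq_zero] at h1
    -- The sum of these products is the squared distance of the centers plus the excess of the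
    -- Delaunay over the Čech squared radius, which is positive since the latter is at most `s` and
    -- the former exceeds `s`.
    obtain ⟨x, hx⟩ : ∃ x, 0 < ρ x * S.power w x := by
      by_contra! hcon
      nlinarith [Finset.sum_nonpos fun x (_ : x ∈ Finset.univ) => hcon x,
        sq_nonneg (dist S.center T.center)]
    have hneg : ρ x < 0 := by
      by_contra! hcon
      have hpos : 0 < ρ x := hcon.lt_of_ne fun h => by rw [← h, zero_mul] at hx; exact hx.false
      have := WSphere.includes_iff.1 (hS.1.1 x (hρ.2.1 x hpos))
      nlinarith
    refine ⟨x, ⟨?_, fun hf => ?_⟩, by nlinarith⟩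
    · by_contra hx'
      exact hneg.ne (hρ.1.1 x hx')
    · exact absurd ((hgen.mem_front_iff hρ.1).1 hf) (not_lt.2 hneg.le)
  · obtain ⟨⟨T, hT, hsT⟩, S, hS, hs⟩ := (hD Q).1 hQ
    rw [hS.leastSphere_eq, hT.leastSphere_eq] at hx
    have hSi := hS.insert (WSphere.includes_iff.2 hx.2.le)
    have hSe := hS.erase (fun h => hx.2.ne (mem_onSet.1 h))
    have hIcc := hgen.insert_erase_mem_Icc hT hx.1.1 hx.1.2
    have hTi := hgen.isLeastSphere_of_mem_Icc hT hIcc.1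
    have hTe := hgen.isLeastSphere_of_mem_Icc hT hIcc.2
    refine ⟨(hD _).2 ⟨⟨T, hTi, hsT⟩, S, hSi, hs⟩, (hD _).2 ⟨⟨T, hTe, hsT⟩, S, hSe, hs⟩, ?_⟩
    rw [hSi.leastSphere_eq, hSe.leastSphere_eq, hTi.leastSphere_eq, hTe.leastSphere_eq]
  · obtain ⟨⟨T, hT, -⟩, S, hS, -⟩ := (hD Q).1 hQ
    obtain ⟨⟨T', hT', -⟩, S', hS', -⟩ := (hD Q').1 hQ'
    rw [hS.leastSphere_eq, hT.leastSphere_eq, hS'.leastSphere_eq, hT'.leastSphere_eq]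
    exact add_le_add (hS.2 _ (hS'.1.mono hle subset_rfl)) (hT.2 _ (hT'.1.mono hle subset_rfl))
  · obtain ⟨⟨T, hT, -⟩, S, hS, -⟩ := (hD Q).1 hQ
    obtain ⟨⟨T', hT', -⟩, S', hS', -⟩ := (hD Q').1 hQ'
    rw [hS.leastSphere_eq, hT.leastSphere_eq, hS'.leastSphere_eq, hT'.leastSphere_eq] at heq
    have h1 := hS.2 _ (hS'.1.mono hle subset_rfl)
    have h2 := hT.2 _ (hT'.1.mono hle subset_rfl)
    have h3 : S = S' := leastSphere_eq_of_subset hS hS' hle (by linarith)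
    have h4 : T = T' := leastSphere_eq_of_subset hT hT' hle (by linarith)
    rw [hS.leastSphere_eq, hT.leastSphere_eq, hS'.leastSphere_eq, hT'.leastSphere_eq, h3, h4]

end DelaunaySpheres

/-! ### Collapsing the Delaunay complex to the Wrap complex -/

section WrapComplex

variable {n : ℕ} {X : Finset (EuclideanSpace ℝ (Fin n))} {w : X → ℝ} {s : ℝ}

theorem InGeneralPosition.isLeastSphere_of_mem_gradient (hgen : InGeneralPosition w)
    {I : Set (Finset X)} (hI : I ∈ delaunayGradient w) :
    ∃ S, I = Set.Icc (front w S) (onSet w S) ∧ ∀ P ∈ I, IsLeastSphere w P Set.univ S := by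
  obtain ⟨Q, -, S, hS, rfl⟩ := hI
  exact ⟨S, rfl, fun P hP => hgen.isLeastSphere_of_mem_Icc (isDelaunaySphere_iff.1 hS) hP⟩

theorem IsLeastSphere.mem_gradient {Q : Finset X} {S : WSphere n}
    (h : IsLeastSphere w Q Set.univ S) :
    Set.Icc (front w S) (onSet w S) ∈ delaunayGradient w :=
  ⟨Q, mem_delaunayTriangulation_iff.2 ⟨S, h⟩, S, isDelaunaySphere_iff.2 h, rfl⟩

theorem InGeneralPosition.mem_Icc (hgen : InGeneralPosition w) {Q : Finset X} {S : WSphere n}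
    (h : IsLeastSphere w Q Set.univ S) : Q ∈ Set.Icc (front w S) (onSet w S) :=
  ⟨hgen.front_subset h, h.1.subset_onSet⟩

/-- The Delaunay radius is constant on intervals and monotone under inclusion, so it never decreases
along a directed path and is bounded by its value at the terminal singular interval. -/
theorem InGeneralPosition.wrapSimplices_subset_delaunay (hgen : InGeneralPosition w) :
    wrapSimplices w s ⊆ (delaunay w s).faces := by
  rintro P ⟨μ, ⟨hμ, ν, ⟨hν, Q, rfl, S, hS, hs⟩, hpath⟩, hP⟩
  induction hpath using Relation.ReflTransGen.head_induction_on generalizing P with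
  | refl =>
    obtain rfl : Q = P := le_antisymm hP.1 hP.2
    exact mem_delaunay_iff.2 ⟨S, isDelaunaySphere_iff.1 hS, hs⟩
  | head harc _ ih =>
    obtain ⟨h1, h2, A, hA, B, hB, hAB⟩ := harc
    obtain ⟨T, -, hT⟩ := hgen.isLeastSphere_of_mem_gradient h1
    obtain ⟨T', hT', hs'⟩ := mem_delaunay_iff.1 (ih hB h2)
    exact mem_delaunay_iff.2 ⟨T, hT P hP,
      ((hT A hA).2 _ (hT'.1.mono hAB subset_rfl)).trans hs'⟩

/-- A nonempty subset of a Wrap simplex is a Delaunay simplex; the inclusion is an arc from its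
interval to one in the lower set. -/
theorem InGeneralPosition.wrap_faces (hgen : InGeneralPosition w) (s : ℝ) :
    (wrap w s).faces = wrapSimplices w s := by
  refine Set.Subset.antisymm ?_ fun Q hQ =>
    ⟨((delaunay w s).isRelLowerSet_faces (hgen.wrapSimplices_subset_delaunay hQ)).1, Q, hQ, subset_rfl⟩
  rintro P ⟨hP, Q, hQ, hPQ⟩
  obtain ⟨T, hT, -⟩ := mem_delaunay_iff.1
    (((delaunay w s).isRelLowerSet_faces (hgen.wrapSimplices_subset_delaunay hQ)).2 hPQ hP)
  obtain ⟨μ, ⟨hμ, ν, hν, hpath⟩, hQμ⟩ := hQ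
  exact ⟨_, ⟨hT.mem_gradient, ν, hν,
    .head ⟨hT.mem_gradient, hμ, P, hgen.mem_Icc hT, Q, hQμ, hPQ⟩ hpath⟩, hgen.mem_Icc hT⟩

theorem InGeneralPosition.wrap_le_delaunay (hgen : InGeneralPosition w) : wrap w ≤ delaunay w :=
  fun s _ hQ => hgen.wrapSimplices_subset_delaunay ((hgen.wrap_faces s).subset hQ)

/-- A simplex determines its Delaunay sphere, so distinct intervals are disjoint and an interval
that meets the Wrap complex lies in it. -/
theorem InGeneralPosition.mem_wrap_of_mem_Icc (hgen : InGeneralPosition w) {P Q : Finset X}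
    {S : WSphere n} (hQ : IsLeastSphere w Q Set.univ S)
    (hP : P ∈ Set.Icc (front w S) (onSet w S)) (hPw : P ∈ wrapSimplices w s) :
    Q ∈ wrapSimplices w s := by
  obtain ⟨μ, hμ, hPμ⟩ := hPw
  obtain ⟨T, rfl, hT⟩ := hgen.isLeastSphere_of_mem_gradient hμ.1
  have hPS := hgen.isLeastSphere_of_mem_Icc hQ hP
  obtain rfl : T = S := leastSphere_eq_of_subset (hT P hPμ) hPS subset_rfl (hPS.2 _ (hT P hPμ).1)
  exact ⟨_, hμ, hgen.mem_Icc hQ⟩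

theorem InGeneralPosition.collapses_delaunay_wrap (hgen : InGeneralPosition w) (s : ℝ) :
    Collapses (delaunay w s) (wrap w s) := by
  classical
  have hD : ∀ Q, Q ∈ (delaunay w s).faces \ (wrap w s).faces ↔
      (∃ T, IsLeastSphere w Q Set.univ T ∧ T.sqRadius ≤ s) ∧ Q ∉ wrapSimplices w s := by
    intro Q
    rw [Set.mem_sdiff, hgen.wrap_faces, mem_delaunay_iff]
  refine collapses_of_matching _ (fun Q => (leastSphere w Set.univ Q).sqRadius)
    (fun Q x => x ∈ onSet w (leastSphere w Set.univ Q) ∧ x ∉ front w (leastSphere w Set.univ Q)) _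
    (hgen.wrap_le_delaunay s) (fun Q hQ => ?_) (fun Q hQ x hx => ?_)
    (fun Q hQ Q' hQ' hle => ?_) (fun Q hQ Q' hQ' hle heq => ?_)
  · obtain ⟨⟨T, hT, hs⟩, hQw⟩ := (hD Q).1 hQ
    rw [hT.leastSphere_eq]
    by_contra! hcon
    -- With nothing to toggle, the interval is the singular one of `Q`, whose radius is at most `s`;
    -- then `Q` would already lie in the Wrap complex.
    have hI : Set.Icc (front w T) (onSet w T) = Set.Icc Q Q := by
      have h1 : front w T = onSet w T := (front_subset_onSet T).antisymm hcon
      have h2 : Q = onSet w T :=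
        h1 ▸ (hgen.mem_Icc hT).2.antisymm (h1 ▸ (hgen.mem_Icc hT).1)
      rw [h1, h2]
    exact hQw ⟨_, ⟨hT.mem_gradient, _, ⟨hT.mem_gradient, Q, hI, T, isDelaunaySphere_iff.2 hT, hs⟩,
      .refl⟩, hgen.mem_Icc hT⟩
  · obtain ⟨⟨T, hT, hs⟩, hQw⟩ := (hD Q).1 hQ
    rw [hT.leastSphere_eq] at hx
    have hIcc := hgen.insert_erase_mem_Icc hT hx.1 hx.2
    have hTi := hgen.isLeastSphere_of_mem_Icc hT hIcc.1
    have hTe := hgen.isLeastSphere_of_mem_Icc hT hIcc.2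
    refine ⟨(hD _).2 ⟨⟨T, hTi, hs⟩, fun h => hQw (hgen.mem_wrap_of_mem_Icc hT hIcc.1 h)⟩,
      (hD _).2 ⟨⟨T, hTe, hs⟩, fun h => hQw (hgen.mem_wrap_of_mem_Icc hT hIcc.2 h)⟩, ?_⟩
    rw [hTi.leastSphere_eq, hTe.leastSphere_eq]
  · obtain ⟨⟨T, hT, -⟩, -⟩ := (hD Q).1 hQ
    obtain ⟨⟨T', hT', -⟩, -⟩ := (hD Q').1 hQ'
    rw [hT.leastSphere_eq, hT'.leastSphere_eq]
    exact hT.2 _ (hT'.1.mono hle subset_rfl)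
  · obtain ⟨⟨T, hT, -⟩, -⟩ := (hD Q).1 hQ
    obtain ⟨⟨T', hT', -⟩, -⟩ := (hD Q').1 hQ'
    rw [hT.leastSphere_eq, hT'.leastSphere_eq] at heq
    have h : T = T' := leastSphere_eq_of_subset hT hT' hle heq.ge
    rw [hT.leastSphere_eq, hT'.leastSphere_eq, h]

end WrapComplex

end WeightedDelaunay

theorem mainTheorem6 (n : ℕ) (X : Finset (EuclideanSpace ℝ (Fin n))) (w : X → ℝ)
    (hgen : WeightedDelaunay.InGeneralPosition w) :
    -- the union of intervals that defines the Wrap complex is a simplicial complex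
    (∀ s : ℝ, (WeightedDelaunay.wrap w s).faces = WeightedDelaunay.wrapSimplices w s) ∧
    -- the levelwise collapses
    (∀ s : ℝ,
      WeightedDelaunay.Collapses (WeightedDelaunay.cech w s) (WeightedDelaunay.delaunayCech w s) ∧
      WeightedDelaunay.Collapses (WeightedDelaunay.delaunayCech w s)
        (WeightedDelaunay.delaunay w s) ∧
      WeightedDelaunay.Collapses (WeightedDelaunay.delaunay w s) (WeightedDelaunay.wrap w s)) ∧
    -- the inclusions of filtrations induce isomorphisms of persistent homology
    ∃ (h₁ : WeightedDelaunay.wrap w ≤ WeightedDelaunay.delaunay w)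
      (h₂ : WeightedDelaunay.delaunay w ≤ WeightedDelaunay.delaunayCech w)
      (h₃ : WeightedDelaunay.delaunayCech w ≤ WeightedDelaunay.cech w),
      ∀ (R : Type u) [Ring R] (M : Type u) [AddCommGroup M] [Module R M] (p : ℕ),
        IsIso (WeightedDelaunay.persistentHomologyMap R M p h₁) ∧
        IsIso (WeightedDelaunay.persistentHomologyMap R M p h₂) ∧
        IsIso (WeightedDelaunay.persistentHomologyMap R M p h₃) := by
  have h₁ := hgen.collapses_delaunay_wrap
  have h₂ := hgen.collapses_delaunayCech_delaunay
  have h₃ := WeightedDelaunay.collapses_cech_delaunayCech w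
  exact ⟨hgen.wrap_faces, fun s => ⟨h₃ s, h₂ s, h₁ s⟩, hgen.wrap_le_delaunay,
    WeightedDelaunay.delaunay_le_delaunayCech, WeightedDelaunay.delaunayCech_le_cech,
    fun R _ M _ _ p => ⟨WeightedDelaunay.isIso_persistentHomologyMap h₁ _ R M p,
      WeightedDelaunay.isIso_persistentHomologyMap h₂ _ R M p,
      WeightedDelaunay.isIso_persistentHomologyMap h₃ _ R M p⟩⟩
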